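/- Let $L\subset\mathbb{R}^n$ be a bimodular lattice of rank $n$: a subgroup of Euclidean $\mathbb{R}^n$ isomorphic to $\mathbb{Z}^n$ such that $v\cdot w\in\mathbb{Z}$ for all $v,w\in L$, and such that the Gram matrix of a $\mathbb{Z}$-basis of $L$ has determinant $2$. Let $L'=\{\xi\in\mathbb{R}^n : \xi\cdot v\in\mathbb{Z}\text{ for all }v\in L\}$ be its dual, let $$\mathrm{Char}(L)=\{\xi\in L' : \xi\cdot v\equiv v\cdot v \pmod 2\text{ for all }v\in L\}$$ be its set of characteristic covectors, and write $\xi^2=\xi\cdot\xi$. Put $\mathrm{Char}_\pm(L)=\{\xi\in\mathrm{Char}(L) : \xi^2\equiv n\pm1 \pmod 8\}$. Then $\mathrm{Char}(L)$ is the disjoint union of $\mathrm{Char}_+(L)$ and $\mathrm{Char}_-(L)$, and the minima $$d_\pm(L)=\min_{\xi\in\mathrm{Char}_\pm(L)}\frac{\xi^2-n}{4}$$ exist (both classes are non-empty and the minima are attained). Moreover $$d_+(L)+d_-(L)\le 0,$$ and if equality holds, then $L$ is isometric to the diagonal lattice $I^{n-1}\oplus A_1$, where $I^{n-1}$ is $\mathbb{Z}^{n-1}$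 with the standard inner product and $A_1$ is the rank-one lattice generated by a vector of square $2$; in particular $d_+(L)=\tfrac14$ and $d_-(L)=-\tfrac14$. -/

import Mathlib

open scoped RealInnerProductSpace

noncomputable section

/-- The dual lattice: the vectors of the ambient space that pair integrally with every element
of `Λ`. -/
def dualLattice {E : Type*} [NormedAddCommGroup E] [InnerProductSpace ℝ E]
    (Λ : Submodule ℤ E) : Submodule ℤ E :=
  LinearMap.BilinForm.dualSubmodule (innerₗ E) Λ

/-- Characteristic covectors: elements `ξ` of the dual lattice with `⟨ξ, v⟩ ≡ v² (mod 2)` for all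
`v ∈ Λ`. -/
def charCovectors {E : Type*} [NormedAddCommGroup E] [InnerProductSpace ℝ E]
    (Λ : Submodule ℤ E) : Set E :=
  {ξ | ξ ∈ dualLattice Λ ∧ ∀ v ∈ Λ, ∃ k : ℤ, ⟪ξ, v⟫ - ⟪v, v⟫ = 2 * (k : ℝ)}

/-- A bimodular lattice of rank `n`: a subgroup `L` of Euclidean `ℝⁿ` that is free of rank `n`,
with integral inner products and with determinant (of the Gram matrix of a `ℤ`-basis) `2`.
The existence of a basis with nonzero Gram determinant forces `L` to be discrete and to span `ℝⁿ`;
the value of the determinant does not depend on the basis. -/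
structure IsBimodular {n : ℕ} (L : Submodule ℤ (EuclideanSpace ℝ (Fin n))) : Prop where
  integral : ∀ v ∈ L, ∀ w ∈ L, ∃ k : ℤ, ⟪v, w⟫ = (k : ℝ)
  det_eq_two : ∃ b : Module.Basis (Fin n) ℤ L,
    (Matrix.gram ℝ (fun i => (b i : EuclideanSpace ℝ (Fin n)))).det = 2

/-- For a sign `s = ±1`, the characteristic covectors `ξ` with `ξ² ≡ n + s (mod 8)`. -/
def charCovectorsSign {n : ℕ} (s : ℤˣ) (L : Submodule ℤ (EuclideanSpace ℝ (Fin n))) :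
    Set (EuclideanSpace ℝ (Fin n)) :=
  {ξ | ξ ∈ charCovectors L ∧ ∃ k : ℤ, ⟪ξ, ξ⟫ - ((n : ℝ) + ((s : ℤ) : ℝ)) = 8 * (k : ℝ)}

/-- The numbers `(ξ² - n) / 4`, for `ξ` in the class of characteristic covectors of sign `s`. -/
def defectValues {n : ℕ} (s : ℤˣ) (L : Submodule ℤ (EuclideanSpace ℝ (Fin n))) : Set ℝ :=
  (fun ξ => (⟪ξ, ξ⟫ - (n : ℝ)) / 4) '' charCovectorsSign s L

/-- The defect `d_s(L)`, `s = ±1`: the minimum of `(ξ² - n) / 4` over the class of sign `s`. It is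
defined as an infimum; that it is attained is part of the theorem. -/
def defect {n : ℕ} (s : ℤˣ) (L : Submodule ℤ (EuclideanSpace ℝ (Fin n))) : ℝ :=
  sInf (defectValues s L)

/-- The lattice `I^m`, generated by the standard orthonormal basis of `ℝ^m`. -/
def latticeI (m : ℕ) : Submodule ℤ (EuclideanSpace ℝ (Fin m)) :=
  Submodule.span ℤ (Set.range (EuclideanSpace.basisFun (Fin m) ℝ))

/-- The root lattice `A₁`, generated in `ℝ` by a vector of square `2`. -/
def latticeA1 : Submodule ℤ ℝ :=
  Submodule.span ℤ {√2}

/-- The orthogonal direct sum of two lattices, in the orthogonal sum of the ambient spaces. -/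
def orthogonalSum {E F : Type*} [NormedAddCommGroup E] [InnerProductSpace ℝ E]
    [NormedAddCommGroup F] [InnerProductSpace ℝ F]
    (Λ₁ : Submodule ℤ E) (Λ₂ : Submodule ℤ F) : Submodule ℤ (WithLp 2 (E × F)) :=
  (Λ₁.prod Λ₂).map (WithLp.linearEquiv 2 ℤ (E × F)).symm.toLinearMap

/-- Isomorphism of lattices: a group isomorphism preserving the inner product. -/
def LatticeIsometric {E F : Type*} [NormedAddCommGroup E] [InnerProductSpace ℝ E]
    [NormedAddCommGroup F] [InnerProductSpace ℝ F]
    (Λ₁ : Submodule ℤ E) (Λ₂ : Submodule ℤ F) : Prop :=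
  ∃ e : Λ₁ ≃ₗ[ℤ] Λ₂, ∀ v w : Λ₁, ⟪(e v : F), (e w : F)⟫ = ⟪(v : E), (w : E)⟫

end

/-! The determinant condition makes L'/L of order two, generated by the class of a vector g with g²
in 1/2 + ℤ. Adjoining (g, g) to L ⊕ L therefore gives a unimodular lattice of rank 2n, the double of
L (`glueLattice`, `isUnimodular_glueLattice`). A characteristic covector of the double is a pair (ξ,
η) of characteristic covectors of L, and van der Blij's congruence ξ² + η² ≡ 2n (mod 8) forces ξ and
η into opposite classes. That every ξ lies in one of the classes follows from the same congruence
for L glued to A₁.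

Elkies' theorem carries the inequality: a unimodular lattice of rank m has a characteristic covector
of norm at most m, and if none is shorter than m the lattice is ℤ^m. For the double, the first
statement gives d₊ + d₋ ≤ 0. If equality holds, no characteristic covector of the double is shorter
than 2n, so the double has an orthonormal basis. Each member of it lies in one summand or has two
components of square 1/2; projecting to the first summand exhibits L as I^(n-1) ⊕ A₁.

Elkies' theorem is proved by comparing the three theta series of U with those of ℤ^m. The
differences h2, h3, h4 are permuted, up to factors, by τ ↦ τ + 1 and τ ↦ -1/τ, so (h2 h3 h4)^8
behaves like a level-one form of weight 12m. The hypothesis on characteristic covectors makes it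
vanish at infinity to order greater than m, hence identically. The theta series then agree, U has as
many unit vectors as ℤ^m, and these contain an orthonormal basis. The transformation laws come from
Poisson summation. -/

noncomputable section

/-! ### Poisson summation on ℝ^ι. -/

open MeasureTheory UnitAddTorus Complex

/-- The Fourier monomial on the torus, evaluated at the class of a real vector. -/
lemma mFourier_coe_apply {ι : Type*} [Fintype ι] (k : ι → ℤ) (x : ι → ℝ) :
    mFourier k (fun i => (x i : UnitAddCircle)) = cexp (2 * Real.pi * I * ∑ i, (k i : ℂ) * x i) := by
  simp only [mFourier, ContinuousMap.coe_mk, fourier_coe_apply, Finset.mul_sum, Complex.exp_sum]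
  refine Finset.prod_congr rfl fun i _ => ?_
  congr 1
  push_cast
  ring

/-- The integer translates of the half-open unit cube tile `ℝ^ι`. -/
lemma integral_eq_tsum_unitCube {ι : Type*} [Fintype ι] {g : (ι → ℝ) → ℂ} (hg : Integrable g) :
    ∫ x, g x = ∑' k : ι → ℤ,
      ∫ x in {x : ι → ℝ | ∀ i, x i ∈ Set.Ioc (0 : ℝ) (0 + 1)}, g (x + fun i => (k i : ℝ)) := by
  set s : (ι → ℤ) → Set (ι → ℝ) := fun k => {x | ∀ i, x i - k i ∈ Set.Ioc (0 : ℝ) (0 + 1)} with hs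
  have hceil : ∀ (k : ι → ℤ) (x : ι → ℝ), x ∈ s k ↔ ∀ i, ⌈x i⌉ - 1 = k i := by
    intro k x
    refine forall_congr' fun i => ?_
    rw [sub_eq_iff_eq_add, Int.ceil_eq_iff]
    simp only [Set.mem_Ioc]
    push_cast
    constructor <;> rintro ⟨h1, h2⟩ <;> constructor <;> linarith
  have hmeas : ∀ k, MeasurableSet (s k) := fun k => by
    refine MeasurableSet.univ_pi' (t := fun i => {y : ℝ | y - k i ∈ Set.Ioc (0 : ℝ) (0 + 1)})
      fun i => ?_
    exact (measurable_id.sub_const _) measurableSet_Ioc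
  have hdisj : Pairwise (Function.onFun Disjoint s) := fun k l hkl => by
    refine Set.disjoint_left.2 fun x hk hl => hkl ?_
    funext i
    rw [← (hceil k x).1 hk i, (hceil l x).1 hl i]
  have huniv : ⋃ k, s k = Set.univ := Set.eq_univ_of_forall fun x =>
    Set.mem_iUnion.2 ⟨fun i => ⌈x i⌉ - 1, (hceil _ x).2 fun i => rfl⟩
  have h := hasSum_integral_iUnion (f := g) (μ := volume) hmeas hdisj hg.integrableOn
  rw [huniv, setIntegral_univ] at h
  rw [← h.tsum_eq]
  refine tsum_congr fun k => ?_
  have hmp := measurePreserving_add_right (volume : Measure (ι → ℝ)) (fun i => (k i : ℝ))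
  rw [← hmp.setIntegral_preimage_emb (measurableEmbedding_addRight _)]
  congr 2
  ext x
  simp [hs]

/-- **Poisson summation** on `ℝ^ι`, for functions whose integer translates are dominated on bounded
sets by a summable family. -/
theorem tsum_int_eq_tsum_fourier {ι : Type*} [Fintype ι] {g : (ι → ℝ) → ℂ} (hg : Continuous g)
    (hint : Integrable g)
    (hbd : ∀ R : ℝ, ∃ u : (ι → ℤ) → ℝ, Summable u ∧
      ∀ k x, ‖x‖ ≤ R → ‖g (x + fun i => (k i : ℝ))‖ ≤ u k)
    (hsum : Summable fun k : ι → ℤ =>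
      ∫ x : ι → ℝ, cexp (-(2 * Real.pi * I * ∑ i, (k i : ℂ) * x i)) * g x) (x : ι → ℝ) :
    ∑' k : ι → ℤ, g (x + fun i => (k i : ℝ)) =
      ∑' k : ι → ℤ, (∫ x : ι → ℝ, cexp (-(2 * Real.pi * I * ∑ i, (k i : ℂ) * x i)) * g x) *
        cexp (2 * Real.pi * I * ∑ i, (k i : ℂ) * x i) := by
  set G : (ι → ℝ) → ℂ := fun x => ∑' k : ι → ℤ, g (x + fun i => (k i : ℝ)) with hG
  have hGc : Continuous G := by
    rw [continuous_iff_continuousAt]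
    intro x₀
    obtain ⟨u, hu, hb⟩ := hbd (‖x₀‖ + 1)
    have : ContinuousOn G (Metric.closedBall 0 (‖x₀‖ + 1)) := by
      refine continuousOn_tsum (fun k => ?_) hu fun k y hy => hb k y (by simpa using hy)
      exact (hg.comp (continuous_id.add continuous_const)).continuousOn
    refine this.continuousAt (Metric.isOpen_ball.mem_nhds ?_ |> fun h =>
      Filter.mem_of_superset h Metric.ball_subset_closedBall)
    simp
  have hper : ∀ (x : ι → ℝ) (l : ι → ℤ), G (x + fun i => (l i : ℝ)) = G x := by
    intro x l
    simp only [hG]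
    rw [← (Equiv.addLeft l).tsum_eq (fun k : ι → ℤ => g (x + fun i => (k i : ℝ)))]
    refine tsum_congr fun k => congrArg g ?_
    funext i
    simp [add_assoc]
  set π : (ι → ℝ) → UnitAddTorus ι := Pi.map fun _ y => (y : UnitAddCircle) with hπ
  have hquot : IsOpenQuotientMap π :=
    IsOpenQuotientMap.piMap fun _ => QuotientAddGroup.isOpenQuotientMap_mk
  have hfib : ∀ x y, π x = π y → G x = G y := by
    intro x y hxy
    have : ∀ i, ∃ l : ℤ, x i = y i + l := by
      intro i
      have h := congrFun hxy i
      simp only [hπ, Pi.map_apply] at h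
      obtain ⟨l, hl⟩ := AddSubgroup.mem_zmultiples_iff.1 (QuotientAddGroup.eq.1 h)
      refine ⟨-l, ?_⟩
      simp only [zsmul_eq_mul, mul_one] at hl
      push_cast
      linarith
    choose l hl using this
    rw [← hper y l]
    congr 1
    funext i
    exact hl i
  -- The periodic sum G is constant on the fibres of the quotient map π, so it descends to a
  -- continuous function on the torus; by `hfib` the section `surjInv` plays no role.
  let F : C(UnitAddTorus ι, ℂ) :=
    ⟨fun t => G (Function.surjInv hquot.surjective t), by
      rw [hquot.isQuotientMap.continuous_iff]
      convert hGc using 1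
      funext y
      exact hfib _ _ (Function.surjInv_eq hquot.surjective _)⟩
  have hF : ∀ y : ι → ℝ, F (fun i => (y i : UnitAddCircle)) = G y := fun y =>
    hfib _ _ (Function.surjInv_eq hquot.surjective (π y))
  have hexp_norm : ∀ (k : ι → ℤ) (y : ι → ℝ),
      ‖cexp (-(2 * Real.pi * I * ∑ i, (k i : ℂ) * y i))‖ = 1 := by
    intro k y
    rw [show -(2 * Real.pi * I * ∑ i, (k i : ℂ) * y i) =
      ((-(2 * Real.pi * ∑ i, (k i : ℝ) * y i) : ℝ) : ℂ) * I by push_cast; ring]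
    exact norm_exp_ofReal_mul_I _
  have hcoeff : ∀ k, mFourierCoeff F k =
      ∫ x : ι → ℝ, cexp (-(2 * Real.pi * I * ∑ i, (k i : ℂ) * x i)) * g x := by
    intro k
    have hcont : Continuous fun x : ι → ℝ => cexp (-(2 * Real.pi * I * ∑ i, (k i : ℂ) * x i)) := by
      fun_prop
    have hint' : Integrable fun x : ι → ℝ =>
        cexp (-(2 * Real.pi * I * ∑ i, (k i : ℂ) * x i)) * g x := by
      refine hint.mono (hcont.mul hg).aestronglyMeasurable (Filter.Eventually.of_forall fun y => ?_)
      rw [norm_mul, hexp_norm, one_mul]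
    -- Unfolding: the integral over the whole space is the sum over translates of the unit cube. The
    -- characters are invariant under these translates, and the domination on the cube allows sum
    -- and integral to be exchanged.
    rw [mFourierCoeff_eq_integral _ k 0, integral_eq_tsum_unitCube hint']
    set C : Set (ι → ℝ) := {x | ∀ i, x i ∈ Set.Ioc (0 : ℝ) (0 + 1)} with hC
    have hCm : MeasurableSet C := MeasurableSet.univ_pi' fun i => measurableSet_Ioc
    have hCle : ∀ y ∈ C, ‖y‖ ≤ 1 := by
      intro y hy
      refine (pi_norm_le_iff_of_nonneg zero_le_one).2 fun i => ?_
      have := hy i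
      simp only [zero_add, Set.mem_Ioc] at this
      rw [Real.norm_eq_abs, abs_of_pos this.1]
      exact this.2
    have hCfin : volume C < ⊤ :=
      (Metric.isBounded_closedBall (x := (0 : ι → ℝ)) (r := 1)).measure_lt_top.trans_le' (measure_mono fun y hy => by
        simpa using hCle y hy)
    have : IsFiniteMeasure (volume.restrict C) := ⟨by simpa using hCfin⟩
    obtain ⟨u, hu, hb⟩ := hbd 1
    have hstep : ∀ (l : ι → ℤ) (y : ι → ℝ),
        cexp (-(2 * Real.pi * I * ∑ i, (k i : ℂ) * (y + fun i => (l i : ℝ)) i)) =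
          cexp (-(2 * Real.pi * I * ∑ i, (k i : ℂ) * y i)) := by
      intro l y
      rw [Complex.exp_eq_exp_iff_exists_int]
      refine ⟨-∑ i, k i * l i, ?_⟩
      simp only [Pi.add_apply]
      push_cast
      simp only [mul_add, Finset.sum_add_distrib]
      ring
    have hbound : ∀ l, ∀ y ∈ C, ‖cexp (-(2 * Real.pi * I * ∑ i, (k i : ℂ) * y i)) *
        g (y + fun i => (l i : ℝ))‖ ≤ u l := by
      intro l y hy
      rw [norm_mul, hexp_norm, one_mul]
      exact hb l y (hCle y hy)
    have hintl : ∀ l : ι → ℤ, Integrable (fun y : ι → ℝ =>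
        cexp (-(2 * Real.pi * I * ∑ i, (k i : ℂ) * y i)) * g (y + fun i => (l i : ℝ)))
        (volume.restrict C) := by
      intro l
      refine Integrable.of_bound (hcont.mul (hg.comp (continuous_id.add continuous_const))).aestronglyMeasurable (u l) ?_
      exact (ae_restrict_iff' hCm).2 (Filter.Eventually.of_forall (hbound l))
    have hsw := hasSum_integral_of_summable_integral_norm hintl (by
      refine Summable.of_nonneg_of_le (fun l => integral_nonneg fun y => norm_nonneg _)
        (fun l => ?_) (hu.mul_left (volume.real C))
      have := setIntegral_mono_on (hintl l).norm (integrableOn_const (C := u l) hCfin.ne) hCm (hbound l)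
      simpa using this)
    simp_rw [hstep]
    rw [hsw.tsum_eq]
    refine setIntegral_congr_fun hCm fun y _ => ?_
    simp only [hF, smul_eq_mul, tsum_mul_left, hG]
    rw [mFourier_coe_apply]
    congr 2
    simp [mul_neg]
  have hS := hasSum_mFourier_series_apply_of_summable (f := F)
    (by simpa only [funext hcoeff] using hsum) (fun i => (x i : UnitAddCircle))
  rw [hF] at hS
  rw [show (∑' k : ι → ℤ, g (x + fun i => (k i : ℝ))) = G x from rfl, ← hS.tsum_eq]
  refine tsum_congr fun k => ?_
  rw [hcoeff, mFourier_coe_apply, smul_eq_mul]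

end

/-! ### Unimodular lattices and convergence of theta series. -/

noncomputable section

open Complex

section Lattice

variable {E : Type*} [NormedAddCommGroup E] [InnerProductSpace ℝ E]

lemma mem_dualLattice {Λ : Submodule ℤ E} {x : E} :
    x ∈ dualLattice Λ ↔ ∀ v ∈ Λ, ∃ k : ℤ, ⟪x, v⟫ = (k : ℝ) := by
  simp only [dualLattice, LinearMap.BilinForm.mem_dualSubmodule, Submodule.mem_one]
  simp [eq_comm]

/-- A lattice is unimodular if it equals its dual. -/
def IsUnimodular (U : Submodule ℤ E) : Prop := dualLattice U = U

namespace IsUnimodular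

variable {U : Submodule ℤ E} (hU : IsUnimodular U)

include hU

lemma mem_iff {x : E} : x ∈ U ↔ ∀ v ∈ U, ∃ k : ℤ, ⟪x, v⟫ = (k : ℝ) := by
  rw [← mem_dualLattice, hU]

lemma integral {v w : E} (hv : v ∈ U) (hw : w ∈ U) : ∃ k : ℤ, ⟪v, w⟫ = (k : ℝ) :=
  hU.mem_iff.1 hv w hw

lemma one_le_norm {v : E} (hv : v ∈ U) (h0 : v ≠ 0) : 1 ≤ ‖v‖ ^ 2 := by
  obtain ⟨k, hk⟩ := hU.integral hv hv
  rw [real_inner_self_eq_norm_sq] at hk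
  have : 0 < ‖v‖ ^ 2 := by positivity
  rw [hk] at this ⊢
  exact_mod_cast this

lemma discreteTopology : DiscreteTopology U := by
  rw [discreteTopology_iff_isOpen_singleton_zero]
  refine ⟨Metric.ball 0 1, Metric.isOpen_ball, ?_⟩
  ext v
  simp only [Set.mem_preimage, mem_ball_zero_iff, Set.mem_singleton_iff]
  refine ⟨fun h => ?_, fun h => by simp [h]⟩
  by_contra h0
  have := hU.one_le_norm v.2 (by simpa using h0)
  nlinarith [norm_nonneg (v : E)]

lemma isZLattice [FiniteDimensional ℝ E] [DiscreteTopology U] : IsZLattice ℝ U where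
  span_top := by
    rw [← Submodule.orthogonal_eq_bot_iff, Submodule.eq_bot_iff]
    intro x hx
    have hx' : ∀ v ∈ U, ⟪x, v⟫ = 0 := fun v hv => by
      rw [real_inner_comm]
      exact (Submodule.mem_orthogonal _ x).1 hx v (Submodule.subset_span hv)
    have hxU : x ∈ U := hU.mem_iff.2 fun v hv => ⟨0, by simp [hx' v hv]⟩
    exact inner_self_eq_zero.1 (hx' x hxU)

end IsUnimodular

end Lattice

section Theta

variable {E : Type*} [NormedAddCommGroup E] [InnerProductSpace ℝ E]

/-- The theta series of a lattice, with coefficients `c` and shift `z`. -/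
def thetaSeries (U : Submodule ℤ E) (c : U → ℂ) (z : E) (τ : ℂ) : ℂ :=
  ∑' v : U, c v * cexp (Real.pi * I * τ * (‖(v : E) + z‖ ^ 2 : ℝ))

lemma norm_cexp_pi_mul_I (τ : ℂ) (r : ℝ) :
    ‖cexp (Real.pi * I * τ * r)‖ = Real.exp (-(Real.pi * τ.im) * r) := by
  rw [Complex.norm_exp]
  congr 1
  simp

variable [FiniteDimensional ℝ E] (U : Submodule ℤ E) [DiscreteTopology U]

/-- From x^N / N! ≤ e^x the Gaussian is bounded by a multiple of ‖v + z‖^(-2N), which is summable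
once 2N exceeds the rank. The possible vector v = -z, where this bound fails, is set aside as a
finite exception. -/
lemma summable_exp_neg_norm_sq {a : ℝ} (ha : 0 < a) (z : E) :
    Summable fun v : U => Real.exp (-a * ‖(v : E) + z‖ ^ 2) := by
  set N := Module.finrank ℤ U + 1
  have h := ZLattice.summable_norm_sub_inv_pow U (2 * N) (by omega) (-z)
  refine Summable.of_norm_bounded_eventually (h.mul_left (N.factorial / a ^ N)) ?_
  have hfin : Set.Finite {v : U | (v : E) + z = 0} :=
    Set.Subsingleton.finite fun v hv w hw => Subtype.ext (by
      have h1 : (v : E) + z = 0 := hv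
      have h2 : (w : E) + z = 0 := hw
      exact add_right_cancel (h1.trans h2.symm))
  filter_upwards [hfin.compl_mem_cofinite] with v hv
  have hv' : (v : E) + z ≠ 0 := hv
  have hpos : 0 < ‖(v : E) + z‖ := norm_pos_iff.2 hv'
  rw [Real.norm_eq_abs, Real.abs_exp, sub_neg_eq_add]
  have h1 := Real.pow_div_factorial_le_exp (a * ‖(v : E) + z‖ ^ 2) (by positivity) N
  rw [neg_mul, Real.exp_neg]
  calc (Real.exp (a * ‖(v : E) + z‖ ^ 2))⁻¹
      ≤ ((a * ‖(v : E) + z‖ ^ 2) ^ N / N.factorial)⁻¹ := inv_anti₀ (by positivity) h1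
    _ = _ := by
      rw [inv_div, mul_pow, ← pow_mul, inv_pow]
      field_simp

variable {U} {c : U → ℂ} (hc : ∀ v, ‖c v‖ ≤ 1)

include hc

omit [InnerProductSpace ℝ E] [FiniteDimensional ℝ E] [DiscreteTopology U] in
lemma norm_thetaSeries_term_le (z : E) (τ : ℂ) (v : U) :
    ‖c v * cexp (Real.pi * I * τ * (‖(v : E) + z‖ ^ 2 : ℝ))‖ ≤
      Real.exp (-(Real.pi * τ.im) * ‖(v : E) + z‖ ^ 2) := by
  rw [norm_mul, norm_cexp_pi_mul_I]
  exact mul_le_of_le_one_left (Real.exp_nonneg _) (hc v)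

lemma summable_thetaSeries (z : E) {τ : ℂ} (hτ : 0 < τ.im) :
    Summable fun v : U => c v * cexp (Real.pi * I * τ * (‖(v : E) + z‖ ^ 2 : ℝ)) :=
  Summable.of_norm_bounded (summable_exp_neg_norm_sq U (by positivity) z)
    (norm_thetaSeries_term_le hc z τ)

lemma differentiableOn_thetaSeries (z : E) :
    DifferentiableOn ℂ (thetaSeries U c z) {τ | 0 < τ.im} := by
  intro τ₀ hτ₀
  have hτ₀' : 0 < τ₀.im := hτ₀
  have hopen : IsOpen {τ : ℂ | τ₀.im / 2 < τ.im} := isOpen_lt continuous_const continuous_im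
  have hd : DifferentiableOn ℂ (thetaSeries U c z) {τ : ℂ | τ₀.im / 2 < τ.im} := by
    refine differentiableOn_tsum_of_summable_norm
      (summable_exp_neg_norm_sq U (a := Real.pi * (τ₀.im / 2)) (by positivity) z)
      (fun v => by fun_prop) hopen fun v τ hτ => ?_
    refine (norm_thetaSeries_term_le hc z τ v).trans (Real.exp_le_exp.2 ?_)
    have : τ₀.im / 2 < τ.im := hτ
    have h1 := mul_le_mul_of_nonneg_left this.le Real.pi_pos.le
    nlinarith [sq_nonneg ‖(v : E) + z‖]
  exact (hd.differentiableAt (hopen.mem_nhds (by simp only [Set.mem_ofPred_eq]; linarith))).differentiableWithinAt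

/-- A theta series all of whose exponents are at least `μ` is `O(exp (-π μ Im τ))`. -/
lemma exists_norm_thetaSeries_le (z : E) {μ : ℝ} (hμ : ∀ v, c v ≠ 0 → μ ≤ ‖(v : E) + z‖ ^ 2) :
    ∃ C : ℝ, 0 ≤ C ∧
      ∀ τ : ℂ, 1 ≤ τ.im → ‖thetaSeries U c z τ‖ ≤ C * Real.exp (-(Real.pi * μ) * τ.im) := by
  have hs := summable_exp_neg_norm_sq U Real.pi_pos z
  -- With q = ‖v + z‖² and t = Im τ, the inequality (t - 1)(q - μ) ≥ 0 gives e^(-πtq) ≤ e^(πμ)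
  -- e^(-πq) e^(-πμt).
  refine ⟨Real.exp (Real.pi * μ) * ∑' v : U, Real.exp (-Real.pi * ‖(v : E) + z‖ ^ 2),
    mul_nonneg (Real.exp_nonneg _) (tsum_nonneg fun v => Real.exp_nonneg _), fun τ hτ => ?_⟩
  rw [mul_right_comm, ← Real.exp_add, ← tsum_mul_left]
  refine tsum_of_norm_bounded (hs.mul_left _).hasSum fun v => ?_
  by_cases hv : c v = 0
  · simp only [hv, zero_mul, norm_zero]
    positivity
  refine (norm_thetaSeries_term_le hc z τ v).trans ?_
  rw [← Real.exp_add, Real.exp_le_exp]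
  have h1 := hμ v hv
  nlinarith [mul_nonneg (mul_nonneg Real.pi_pos.le (sub_nonneg.2 hτ)) (sub_nonneg.2 h1)]

end Theta

end

/-! ### The inversion formula for theta series. -/

noncomputable section

open Complex MeasureTheory Module

section Inversion

variable {E : Type*} [NormedAddCommGroup E] [InnerProductSpace ℝ E]

lemma innerₗ_nondegenerate : LinearMap.BilinForm.Nondegenerate (innerₗ E) := by
  constructor
  · intro x hx
    exact inner_self_eq_zero.1 (hx x)
  · intro x hx
    exact inner_self_eq_zero.1 (hx x)

omit [InnerProductSpace ℝ E] in
lemma exists_equiv_span_int [NormedSpace ℝ E] {ι : Type*} [Fintype ι] {U : Submodule ℤ E}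
    (d : Basis ι ℝ E) (h : Submodule.span ℤ (Set.range d) = U) :
    ∃ e : (ι → ℤ) ≃ U, ∀ k, (e k : E) = ∑ i, (k i : ℝ) • d i := by
  subst h
  refine ⟨(d.restrictScalars ℤ).equivFun.symm.toEquiv, fun k => ?_⟩
  simp [Basis.equivFun_symm_apply, Int.cast_smul_eq_zsmul]

/-- The dual basis of a basis of a unimodular lattice generates the same lattice. -/
lemma IsUnimodular.span_dualBasis {ι : Type*} [Fintype ι] [DecidableEq ι] {U : Submodule ℤ E}
    (hU : IsUnimodular U) (b : Basis ι ℝ E) (hb : Submodule.span ℤ (Set.range b) = U) :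
    Submodule.span ℤ (Set.range (LinearMap.BilinForm.dualBasis (innerₗ E) innerₗ_nondegenerate b))
      = U := by
  rw [← LinearMap.BilinForm.dualSubmodule_span_of_basis, hb]
  exact hU

/-- The factor of automorphy `(-iτ)^(-m/2)` in the inversion formula for theta series. -/
def thetaFactor (m : ℕ) (τ : ℂ) : ℂ := (Real.pi / (-(Real.pi * I * τ))) ^ ((m : ℂ) / 2)

variable [FiniteDimensional ℝ E] {U : Submodule ℤ E}

lemma IsUnimodular.exists_basis (hU : IsUnimodular U) :
    ∃ b : Basis (Fin (finrank ℝ E)) ℝ E, Submodule.span ℤ (Set.range b) = U := by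
  have := hU.discreteTopology
  have := hU.isZLattice
  let b := (Free.chooseBasis ℤ U).ofZLatticeBasis ℝ U
  have hb : Submodule.span ℤ (Set.range b) = U := Basis.ofZLatticeBasis_span ℝ _ _
  refine ⟨b.reindex (Fintype.equivFinOfCardEq (finrank_eq_card_basis b).symm), ?_⟩
  rw [Basis.range_reindex, hb]

/-- Poisson summation for a Gaussian, in the coordinates of a lattice basis. The frequencies run
over the span of the dual basis, which is U again. The constant κ compares the coordinate measure
with the Euclidean one and is left unevaluated here. -/
lemma IsUnimodular.exists_thetaSeries_eq (hU : IsUnimodular U) :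
    ∃ κ : ℝ, ∀ (z : E) (τ : ℂ), 0 < τ.im →
      thetaSeries U 1 z τ = κ * thetaFactor (finrank ℝ E) τ *
        thetaSeries U (fun v => cexp (2 * Real.pi * I * ⟪(v : E), z⟫)) 0 (-1 / τ) := by
  classical
  let : MeasurableSpace E := borel E
  have : BorelSpace E := ⟨rfl⟩
  have := hU.discreteTopology
  have := hU.isZLattice
  obtain ⟨b, hb⟩ := hU.exists_basis
  let d := LinearMap.BilinForm.dualBasis (innerₗ E) innerₗ_nondegenerate b
  obtain ⟨Φ, hΦ⟩ := exists_equiv_span_int b hb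
  obtain ⟨Ψ, hΨ⟩ := exists_equiv_span_int d (hU.span_dualBasis b hb)
  let T : (Fin (finrank ℝ E) → ℝ) ≃L[ℝ] E := b.equivFunL.symm
  have hT : ∀ x, T x = ∑ i, x i • b i := fun x => Basis.equivFun_symm_apply b x
  have hTΦ : ∀ k : Fin (finrank ℝ E) → ℤ, T (fun i => (k i : ℝ)) = Φ k := fun k => by rw [hT, hΦ]
  have hpair : ∀ (k : Fin (finrank ℝ E) → ℤ) (x : Fin (finrank ℝ E) → ℝ), ⟪(Ψ k : E), T x⟫ = ∑ i, (k i : ℝ) * x i := by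
    intro k x
    rw [hT, hΨ, sum_inner]
    refine Finset.sum_congr rfl fun i _ => ?_
    rw [inner_sum, Finset.sum_eq_single i]
    · have := LinearMap.BilinForm.apply_dualBasis_left innerₗ_nondegenerate b i i
      simp only [innerₗ_apply_apply, if_true] at this
      rw [real_inner_smul_left, real_inner_smul_right, this, mul_one]
    · intro j _ hj
      have := LinearMap.BilinForm.apply_dualBasis_left innerₗ_nondegenerate b i j
      simp only [innerₗ_apply_apply, if_neg hj] at this
      rw [real_inner_smul_left, real_inner_smul_right, this, mul_zero, mul_zero]
    · simp
  have hmap : ((volume : Measure (Fin (finrank ℝ E) → ℝ)).map T) =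
      ((volume : Measure (Fin (finrank ℝ E) → ℝ)).map T).addHaarScalarFactor volume • (volume : Measure E) := by
    have := T.isAddHaarMeasure_map (volume : Measure (Fin (finrank ℝ E) → ℝ))
    exact Measure.isAddLeftInvariant_eq_smul _ _
  set κ := ((volume : Measure (Fin (finrank ℝ E) → ℝ)).map T).addHaarScalarFactor (volume : Measure E)
  refine ⟨κ, fun z τ hτ => ?_⟩
  set β : ℂ := -(Real.pi * I * τ) with hβ
  have hβre : 0 < β.re := by
    simp [hβ]
    positivity
  have hτ0 : τ ≠ 0 := by
    rintro rfl
    simp at hτ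
  have hint : ∀ G : E → ℂ, ∫ x : Fin (finrank ℝ E) → ℝ, G (T x) = κ * ∫ y, G y := by
    intro G
    have h1 := integral_map_equiv (μ := (volume : Measure (Fin (finrank ℝ E) → ℝ))) T.toHomeomorph.toMeasurableEquiv G
    have h2 : (volume : Measure (Fin (finrank ℝ E) → ℝ)).map T.toHomeomorph.toMeasurableEquiv =
      (volume : Measure (Fin (finrank ℝ E) → ℝ)).map T := rfl
    rw [h2, hmap, integral_smul_nnreal_measure] at h1
    rw [NNReal.smul_def, real_smul] at h1
    exact h1.symm
  set g : (Fin (finrank ℝ E) → ℝ) → ℂ := fun x => cexp (Real.pi * I * τ * (‖T x‖ ^ 2 : ℝ)) with hg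
  have hgc : Continuous g := by
    have := T.continuous
    fun_prop
  have hgi : Integrable g := by
    have h1 := integrable_map_equiv (μ := (volume : Measure (Fin (finrank ℝ E) → ℝ))) T.toHomeomorph.toMeasurableEquiv
      (fun y : E => cexp (-β * ‖y‖ ^ 2 + 0 * ⟪(0 : E), y⟫))
    have h2 : (volume : Measure (Fin (finrank ℝ E) → ℝ)).map T.toHomeomorph.toMeasurableEquiv =
      (volume : Measure (Fin (finrank ℝ E) → ℝ)).map T := rfl
    rw [h2, hmap] at h1
    have h3 := h1.1 ((GaussianFourier.integrable_cexp_neg_mul_sq_norm_add hβre 0 0).smul_measure_nnreal)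
    refine h3.congr (Filter.Eventually.of_forall fun x => ?_)
    simp [hg, hβ]
  have hbd : ∀ R : ℝ, ∃ u : (Fin (finrank ℝ E) → ℤ) → ℝ, Summable u ∧
      ∀ k x, ‖x‖ ≤ R → ‖g (x + fun i => (k i : ℝ))‖ ≤ u k := by
    intro R
    set R' := ‖(T : (Fin (finrank ℝ E) → ℝ) →L[ℝ] E)‖ * R
    have hs := (summable_exp_neg_norm_sq U (a := Real.pi * τ.im / 2) (by positivity) 0).mul_left
      (Real.exp (Real.pi * τ.im * R' ^ 2))
    refine ⟨_, (Equiv.summable_iff Φ).2 hs, fun k x hx => ?_⟩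
    simp only [hg, map_add, hTΦ, norm_cexp_pi_mul_I, Function.comp, add_zero]
    rw [← Real.exp_add, Real.exp_le_exp]
    have h1 : ‖T x‖ ≤ R' := ((T : (Fin (finrank ℝ E) → ℝ) →L[ℝ] E).le_opNorm x).trans
      (mul_le_mul_of_nonneg_left hx (norm_nonneg _))
    have h2 : ‖T x‖ ^ 2 ≤ R' ^ 2 := by gcongr
    have h3 : ‖(Φ k : E)‖ ^ 2 ≤ 2 * ‖T x + Φ k‖ ^ 2 + 2 * ‖T x‖ ^ 2 := by
      have h4 : ‖(Φ k : E)‖ ≤ ‖T x + Φ k‖ + ‖T x‖ := by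
        simpa using norm_sub_le (T x + (Φ k : E)) (T x)
      nlinarith [norm_nonneg (Φ k : E), sq_nonneg (‖T x + Φ k‖ - ‖T x‖)]
    have hp : 0 < Real.pi * τ.im := by positivity
    nlinarith
  have hhat : ∀ k : Fin (finrank ℝ E) → ℤ, ∫ x : Fin (finrank ℝ E) → ℝ, cexp (-(2 * Real.pi * I * ∑ i, (k i : ℂ) * x i)) * g x =
      κ * thetaFactor (finrank ℝ E) τ *
        cexp (Real.pi * I * (-1 / τ) * (‖(Ψ k : E)‖ ^ 2 : ℝ)) := by
    intro k
    have h1 := GaussianFourier.integral_cexp_neg_mul_sq_norm_add hβre (-(2 * Real.pi * I)) (Ψ k : E)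
    have h2 := hint fun y => cexp (-β * ‖y‖ ^ 2 + -(2 * Real.pi * I) * ⟪(Ψ k : E), y⟫)
    rw [h1] at h2
    refine Eq.trans ?_ (h2.trans ?_)
    · congr 1
      funext x
      rw [← Complex.exp_add, hpair]
      congr 1
      push_cast
      simp only [hβ]
      ring
    · have hpi : (Real.pi : ℂ) ≠ 0 := by exact_mod_cast Real.pi_ne_zero
      have hexp : (-(2 * Real.pi * I)) ^ 2 * (‖(Ψ k : E)‖ : ℂ) ^ 2 / (4 * β) =
          Real.pi * I * (-1 / τ) * (‖(Ψ k : E)‖ ^ 2 : ℝ) := by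
        push_cast
        simp only [hβ]
        field_simp
        ring
      rw [hexp, thetaFactor, ← hβ, ← mul_assoc]
  have hτ' : 0 < (-1 / τ).im := by
    rw [neg_div, one_div, neg_im, inv_im, neg_div, neg_neg]
    exact div_pos hτ (normSq_pos.2 hτ0)
  have hsum : Summable fun k : Fin (finrank ℝ E) → ℤ =>
      ∫ x : Fin (finrank ℝ E) → ℝ, cexp (-(2 * Real.pi * I * ∑ i, (k i : ℂ) * x i)) * g x := by
    simp_rw [hhat]
    refine Summable.mul_left _ ?_
    have := summable_thetaSeries (U := U) (c := fun _ => 1) (by simp) 0 hτ'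
    simpa [Function.comp_def] using (Equiv.summable_iff Ψ).2 this
  have key := tsum_int_eq_tsum_fourier hgc hgi hbd hsum (T.symm z)
  simp_rw [hhat] at key
  simp only [hg, map_add, hTΦ, T.apply_symm_apply] at key
  rw [thetaSeries, thetaSeries, ← Φ.tsum_eq, ← Ψ.tsum_eq, ← tsum_mul_left]
  convert key using 1
  · simp [add_comm]
  · refine tsum_congr fun k => ?_
    have h1 := hpair k (T.symm z)
    rw [T.apply_symm_apply] at h1
    rw [h1, add_zero]
    push_cast
    ring

omit [InnerProductSpace ℝ E] [FiniteDimensional ℝ E] in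
lemma thetaSeries_one_ofReal_mul_I (z : E) (t : ℝ) :
    thetaSeries U 1 z (t * I) = (∑' v : U, Real.exp (-(Real.pi * t) * ‖(v : E) + z‖ ^ 2) : ℝ) := by
  rw [thetaSeries, ofReal_tsum]
  refine tsum_congr fun v => ?_
  rw [Pi.one_apply, one_mul, ofReal_exp]
  congr 1
  push_cast
  linear_combination (Real.pi * t * ‖(v : E) + z‖ ^ 2 : ℂ) * I_sq

lemma thetaSeries_one_ne_zero [DiscreteTopology U] (z : E) {t : ℝ} (ht : 0 < t) :
    thetaSeries U 1 z (t * I) ≠ 0 := by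
  rw [thetaSeries_one_ofReal_mul_I, ofReal_ne_zero]
  exact ((summable_exp_neg_norm_sq U (by positivity) z).tsum_pos (fun v => Real.exp_nonneg _) 0
    (Real.exp_pos _)).ne'

lemma thetaFactor_I (m : ℕ) : thetaFactor m I = 1 := by
  have hpi : (Real.pi : ℂ) ≠ 0 := by exact_mod_cast Real.pi_ne_zero
  rw [thetaFactor, mul_assoc, I_mul_I, mul_neg_one, neg_neg, div_self hpi, one_cpow]

/-- The base is i/τ, and i^12 = 1. The exponent 24 is that of the eighth power of a product of three
theta functions. -/
lemma thetaFactor_pow (m : ℕ) {τ : ℂ} (hτ : τ ≠ 0) : thetaFactor m τ ^ 24 * τ ^ (12 * m) = 1 := by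
  have hpi : (Real.pi : ℂ) ≠ 0 := by exact_mod_cast Real.pi_ne_zero
  have h1 : (Real.pi : ℂ) / (-(Real.pi * I * τ)) = I / τ := by
    field_simp
    linear_combination -I_sq
  rw [thetaFactor, ← cpow_nat_mul, h1,
    show ((24 : ℕ) : ℂ) * (m / 2) = ((12 * m : ℕ) : ℂ) by push_cast; ring, cpow_natCast, div_pow,
    pow_mul, show I ^ 12 = 1 by rw [show 12 = 4 * 3 from rfl, pow_mul, I_pow_four, one_pow],
    one_pow, one_div_mul_cancel (pow_ne_zero _ hτ)]

/-- The **inversion formula** for theta series of a unimodular lattice. -/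
theorem IsUnimodular.thetaSeries_one (hU : IsUnimodular U) (z : E) {τ : ℂ} (hτ : 0 < τ.im) :
    thetaSeries U 1 z τ = thetaFactor (finrank ℝ E) τ *
      thetaSeries U (fun v => cexp (2 * Real.pi * I * ⟪(v : E), z⟫)) 0 (-1 / τ) := by
  have := hU.discreteTopology
  obtain ⟨κ, hκ⟩ := hU.exists_thetaSeries_eq
  -- Since i is fixed by τ ↦ -1/τ and the theta series is nonzero there, this evaluation forces κ =
  -- 1.
  have h1 := hκ 0 I (by simp)
  have h2 := thetaSeries_one_ne_zero (U := U) 0 one_pos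
  rw [ofReal_one, one_mul] at h2
  have h3 : (fun v : U => cexp (2 * Real.pi * I * ⟪(v : E), (0 : E)⟫)) = 1 := by
    funext v
    simp
  rw [h3, thetaFactor_I, mul_one, neg_div, one_div, inv_I, neg_neg] at h1
  have h4 : (κ : ℂ) = 1 := mul_right_cancel₀ h2 (by rw [← h1, one_mul])
  rw [hκ z τ hτ, h4, one_mul]

end Inversion

end

/-! ### Three theta functions, their transformation laws, and van der Blij's congruence. -/

noncomputable section

open Complex Module

section CharacteristicTheta

variable {E : Type*} [NormedAddCommGroup E] [InnerProductSpace ℝ E]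

lemma neg_one_div_im_pos {τ : ℂ} (hτ : 0 < τ.im) : 0 < (-1 / τ).im := by
  have hτ0 : τ ≠ 0 := by
    rintro rfl
    simp at hτ
  rw [neg_div, one_div, neg_im, inv_im, neg_div, neg_neg]
  exact div_pos hτ (normSq_pos.2 hτ0)

/-- The two bases are inverse to each other, and i/τ has positive real part, so the principal power
stays off its branch cut and commutes with inversion. -/
lemma thetaFactor_neg_one_div (m : ℕ) {τ : ℂ} (hτ : 0 < τ.im) :
    thetaFactor m τ * thetaFactor m (-1 / τ) = 1 := by
  have hτ0 : τ ≠ 0 := by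
    rintro rfl
    simp at hτ
  have hpi : (Real.pi : ℂ) ≠ 0 := by exact_mod_cast Real.pi_ne_zero
  have h1 : (Real.pi : ℂ) / (-(Real.pi * I * (-1 / τ))) =
      ((Real.pi : ℂ) / (-(Real.pi * I * τ)))⁻¹ := by
    field_simp
    linear_combination I_sq
  have h2 : (Real.pi : ℂ) / (-(Real.pi * I * τ)) = I / τ := by
    field_simp
    linear_combination -I_sq
  rw [thetaFactor, thetaFactor, h1, inv_cpow, mul_inv_cancel₀]
  · rw [Ne, cpow_eq_zero_iff]
    simp [hpi, hτ0]
  · rw [h2]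
    intro h
    have h3 : (I / τ).re < 0 := (arg_eq_pi_iff.1 h).1
    rw [div_re, I_re, I_im, zero_mul, zero_div, zero_add, one_mul] at h3
    exact absurd (div_pos hτ (normSq_pos.2 hτ0)) h3.not_gt

/-- The theta series of a lattice, as a function on the upper half plane. -/
def theta3 (U : Submodule ℤ E) : ℂ → ℂ := thetaSeries U 1 0

/-- The theta series of the coset of half the characteristic covectors. -/
def theta2 (U : Submodule ℤ E) (w : E) : ℂ → ℂ := thetaSeries U 1 ((1 / 2 : ℝ) • w)

/-- The theta series twisted by the parity of the norm, expressed by a characteristic covector. -/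
def theta4 (U : Submodule ℤ E) (w : E) : ℂ → ℂ :=
  thetaSeries U (fun v => cexp (2 * Real.pi * I * ⟪(v : E), (1 / 2 : ℝ) • w⟫)) 0

lemma norm_thetaCharacter (z v : E) : ‖cexp (2 * Real.pi * I * ⟪v, z⟫)‖ ≤ 1 := by
  rw [show 2 * Real.pi * I * (⟪v, z⟫ : ℂ) = ((2 * Real.pi * ⟪v, z⟫ : ℝ) : ℂ) * I by
    push_cast; ring]
  exact (norm_exp_ofReal_mul_I _).le

variable {U : Submodule ℤ E} {w : E}

lemma cexp_two_pi_half_inner (hw : w ∈ charCovectors U) (v : U) :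
    cexp (2 * Real.pi * I * ⟪(v : E), (1 / 2 : ℝ) • w⟫) =
      cexp (Real.pi * I * (‖(v : E)‖ ^ 2 : ℝ)) := by
  obtain ⟨k, hk⟩ := hw.2 v v.2
  rw [Complex.exp_eq_exp_iff_exists_int]
  refine ⟨k, ?_⟩
  rw [← real_inner_self_eq_norm_sq, real_inner_smul_right, real_inner_comm,
    show ⟪w, (v : E)⟫ = ⟪(v : E), (v : E)⟫ + 2 * k by linarith]
  push_cast
  ring

/-- The parity character of an integral lattice has order two. -/
lemma cexp_two_pi_half_inner_mul_self (hw : w ∈ charCovectors U) (v : U) :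
    cexp (2 * Real.pi * I * ⟪(v : E), (1 / 2 : ℝ) • w⟫) *
      cexp (Real.pi * I * (‖(v : E)‖ ^ 2 : ℝ)) = 1 := by
  obtain ⟨l, hl⟩ := mem_dualLattice.1 hw.1 v v.2
  rw [← cexp_two_pi_half_inner hw, ← Complex.exp_add, Complex.exp_eq_one_iff]
  refine ⟨l, ?_⟩
  rw [real_inner_smul_right, real_inner_comm, hl]
  push_cast
  ring

lemma theta3_add_one (hw : w ∈ charCovectors U) (τ : ℂ) : theta3 U (τ + 1) = theta4 U w τ := by
  refine tsum_congr fun v => ?_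
  beta_reduce
  rw [cexp_two_pi_half_inner hw, Pi.one_apply, one_mul, ← Complex.exp_add, add_zero]
  congr 1
  ring

lemma theta4_add_one (hw : w ∈ charCovectors U) (τ : ℂ) : theta4 U w (τ + 1) = theta3 U τ := by
  refine tsum_congr fun v => ?_
  rw [Pi.one_apply, one_mul, add_zero, mul_add, add_mul, Complex.exp_add, mul_left_comm, mul_one,
    cexp_two_pi_half_inner_mul_self hw, mul_one]

/-- The exponents agree modulo 2 on the coset: ‖v + w/2‖² = v² + ⟨v, w⟩ + w²/4, and v² + ⟨v, w⟩ is
even because w is characteristic. -/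
lemma theta2_add_one (hU : IsUnimodular U) (hw : w ∈ charCovectors U) (τ : ℂ) :
    theta2 U w (τ + 1) = cexp (Real.pi * I * (‖w‖ ^ 2 / 4 : ℝ)) * theta2 U w τ := by
  rw [theta2, thetaSeries, thetaSeries, ← tsum_mul_left]
  refine tsum_congr fun v => ?_
  obtain ⟨k, hk⟩ := hw.2 v v.2
  obtain ⟨l, hl⟩ := hU.integral v.2 v.2
  rw [Pi.one_apply, one_mul, one_mul, ← Complex.exp_add, Complex.exp_eq_exp_iff_exists_int]
  refine ⟨k + l, ?_⟩
  have h1 : ‖(v : E) + (1 / 2 : ℝ) • w‖ ^ 2 = 2 * (k + l : ℤ) + ‖w‖ ^ 2 / 4 := by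
    rw [norm_add_sq_real, ← real_inner_self_eq_norm_sq, real_inner_smul_right,
      real_inner_comm w (v : E), norm_smul, mul_pow, Real.norm_eq_abs, sq_abs]
    push_cast
    linarith
  have h2 : Real.pi * I * (τ + 1) * (‖(v : E) + (1 / 2 : ℝ) • w‖ ^ 2 : ℝ) =
    Real.pi * I * (‖(v : E) + (1 / 2 : ℝ) • w‖ ^ 2 : ℝ) +
      Real.pi * I * τ * (‖(v : E) + (1 / 2 : ℝ) • w‖ ^ 2 : ℝ) := by ring
  rw [h2]
  nth_rewrite 1 [h1]
  push_cast
  ring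

variable [FiniteDimensional ℝ E]

lemma theta3_inversion (hU : IsUnimodular U) {τ : ℂ} (hτ : 0 < τ.im) :
    theta3 U τ = thetaFactor (finrank ℝ E) τ * theta3 U (-1 / τ) := by
  rw [theta3, hU.thetaSeries_one 0 hτ]
  congr 2
  funext v
  simp

lemma theta2_inversion (hU : IsUnimodular U) (w : E) {τ : ℂ} (hτ : 0 < τ.im) :
    theta2 U w τ = thetaFactor (finrank ℝ E) τ * theta4 U w (-1 / τ) :=
  hU.thetaSeries_one _ hτ

lemma theta4_inversion (hU : IsUnimodular U) (w : E) {τ : ℂ} (hτ : 0 < τ.im) :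
    theta4 U w τ = thetaFactor (finrank ℝ E) τ * theta2 U w (-1 / τ) := by
  have hτ0 : τ ≠ 0 := by
    rintro rfl
    simp at hτ
  rw [theta2_inversion hU w (neg_one_div_im_pos hτ), ← mul_assoc, thetaFactor_neg_one_div _ hτ,
    one_mul, show -1 / (-1 / τ) = τ by field_simp]

/-- The translation multiplier of `theta2` depends only on the rank of the lattice. -/
lemma cexp_norm_sq_charCovector (hU : IsUnimodular U) (hw : w ∈ charCovectors U) :
    cexp (Real.pi * I * (‖w‖ ^ 2 / 4 : ℝ)) =
      thetaFactor (finrank ℝ E) (I + 1) * thetaFactor (finrank ℝ E) (-1 / (I + 1) + 1) := by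
  have := hU.discreteTopology
  have hI : (I + 1 : ℂ) ≠ 0 := fun h => by simpa using congrArg Complex.im h
  have him : 0 < (I + 1 : ℂ).im := by simp
  have him' : 0 < (-1 / (I + 1) + 1 : ℂ).im := by
    rw [add_im, one_im, add_zero]
    exact neg_one_div_im_pos him
  have hne : theta2 U w I ≠ 0 := by
    have := thetaSeries_one_ne_zero (U := U) ((1 / 2 : ℝ) • w) one_pos
    rwa [ofReal_one, one_mul] at this
  have h1 := theta2_add_one hU hw I
  -- Inverting, translating, inverting and translating again leads from i + 1 to -1/i. The factors
  -- collected on the way depend only on the rank, and `theta2` can be cancelled because it does not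
  -- vanish at i.
  rw [theta2_inversion hU w him, ← theta3_add_one hw, theta3_inversion hU him',
    ← theta4_add_one hw] at h1
  have h2 : -1 / (-1 / (I + 1) + 1) + 1 = (-1 / I : ℂ) := by
    have h3 : (-1 / (I + 1) + 1 : ℂ) = I / (I + 1) := by field_simp; ring
    rw [h3]
    field_simp
    ring
  have h4 := theta2_inversion hU w (τ := I) (by simp)
  rw [thetaFactor_I, one_mul] at h4
  rw [h2, ← h4, ← mul_assoc] at h1
  exact (mul_right_cancel₀ hne h1).symm

/-- Every unimodular lattice has a characteristic covector. -/
lemma IsUnimodular.exists_charCovector (hU : IsUnimodular U) : ∃ w, w ∈ charCovectors U := by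
  classical
  obtain ⟨b, hb⟩ := hU.exists_basis
  set d := LinearMap.BilinForm.dualBasis (innerₗ E) innerₗ_nondegenerate b with hd
  have hd' := hU.span_dualBasis b hb
  have hbU : ∀ i, b i ∈ U := fun i => hb ▸ Submodule.subset_span ⟨i, rfl⟩
  have hdU : ∀ i, d i ∈ U := fun i => by
    rw [← hd']
    exact Submodule.subset_span ⟨i, rfl⟩
  choose k hk using fun i => hU.integral (hbU i) (hbU i)
  -- Coordinates b_i² in the dual basis give ⟨w, b_j⟩ = b_j². This suffices, because v ↦ v² mod 2 is
  -- additive on an integral lattice.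
  set w := ∑ i, k i • d i with hw
  have hwU : w ∈ U := Submodule.sum_mem _ fun i _ => Submodule.smul_mem _ _ (hdU i)
  have hwb : ∀ j, ⟪w, b j⟫ = ⟪b j, b j⟫ := by
    intro j
    rw [hw, sum_inner, Finset.sum_eq_single j]
    · have := LinearMap.BilinForm.apply_dualBasis_left innerₗ_nondegenerate b j j
      simp only [innerₗ_apply_apply, if_true] at this
      rw [← Int.cast_smul_eq_zsmul ℝ, real_inner_smul_left, this, mul_one, hk]
    · intro i _ hi
      have := LinearMap.BilinForm.apply_dualBasis_left innerₗ_nondegenerate b i j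
      simp only [innerₗ_apply_apply, if_neg hi.symm] at this
      rw [← Int.cast_smul_eq_zsmul ℝ, real_inner_smul_left, this, mul_zero]
    · simp
  refine ⟨w, hU.symm ▸ hwU, fun v hv => ?_⟩
  have hgen : v ∈ Submodule.span ℤ (Set.range b) := hb.symm ▸ hv
  clear hv
  induction hgen using Submodule.span_induction with
  | mem x hx =>
    obtain ⟨j, rfl⟩ := hx
    exact ⟨0, by simp [hwb]⟩
  | zero => exact ⟨0, by simp⟩
  | add x y hx hy ihx ihy =>
    obtain ⟨p, hp⟩ := ihx
    obtain ⟨q, hq⟩ := ihy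
    obtain ⟨r, hr⟩ := hU.integral (hb ▸ hx) (hb ▸ hy)
    refine ⟨p + q - r, ?_⟩
    rw [inner_add_right, real_inner_add_add_self, hr]
    push_cast
    linarith
  | smul a x hx ih =>
    obtain ⟨p, hp⟩ := ih
    obtain ⟨r, hr⟩ := hU.integral (hb ▸ hx) (hb ▸ hx)
    obtain ⟨s, hs⟩ := Int.even_mul_pred_self a
    refine ⟨a * p - s * r, ?_⟩
    rw [← Int.cast_smul_eq_zsmul ℝ, real_inner_smul_right, real_inner_smul_left,
      real_inner_smul_right]
    have hs' : (a : ℝ) * (a - 1) = s + s := by exact_mod_cast hs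
    push_cast
    linear_combination (a : ℝ) * hp + (-(a : ℝ) * (a - 1)) * hr - (r : ℝ) * hs'

end CharacteristicTheta

section StandardLattice

variable {E ι : Type*} [NormedAddCommGroup E] [InnerProductSpace ℝ E] [Fintype ι]

/-- The lattice generated by an orthonormal basis consists of the vectors with integral
coordinates. -/
lemma mem_span_orthonormalBasis (e : OrthonormalBasis ι ℝ E) {x : E} :
    x ∈ Submodule.span ℤ (Set.range e) ↔ ∀ i, ∃ k : ℤ, ⟪e i, x⟫ = (k : ℝ) := by
  have h := e.toBasis.mem_span_iff_repr_mem ℤ x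
  rw [OrthonormalBasis.coe_toBasis] at h
  rw [h]
  refine forall_congr' fun i => ?_
  rw [OrthonormalBasis.coe_toBasis_repr_apply, OrthonormalBasis.repr_apply_apply]
  simp [eq_comm]

lemma isUnimodular_span_orthonormalBasis (e : OrthonormalBasis ι ℝ E) :
    IsUnimodular (Submodule.span ℤ (Set.range e)) := by
  ext x
  rw [mem_dualLattice, mem_span_orthonormalBasis]
  constructor
  · intro h i
    obtain ⟨k, hk⟩ := h (e i) (Submodule.subset_span ⟨i, rfl⟩)
    exact ⟨k, by rw [real_inner_comm, hk]⟩
  · intro h v hv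
    choose k hk using h
    choose l hl using (mem_span_orthonormalBasis e).1 hv
    refine ⟨∑ i, k i * l i, ?_⟩
    rw [← e.sum_inner_mul_inner x v]
    push_cast
    refine Finset.sum_congr rfl fun i _ => ?_
    rw [real_inner_comm, hk, hl]

/-- A vector having odd inner products with the members of an orthonormal family is at least as
long as their sum. -/
lemma card_le_norm_sq_of_odd {e : ι → E} (he : Orthonormal ℝ e) {w : E}
    (hw : ∀ i, ∃ k : ℤ, ⟪w, e i⟫ = 2 * k + 1) : (Fintype.card ι : ℝ) ≤ ‖w‖ ^ 2 := by
  refine le_trans ?_ (he.sum_inner_products_le w (s := Finset.univ))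
  rw [Fintype.card_eq_sum_ones]
  push_cast
  refine Finset.sum_le_sum fun i _ => ?_
  obtain ⟨k, hk⟩ := hw i
  rw [real_inner_comm, hk, Real.norm_eq_abs, sq_abs]
  have : (0 : ℤ) ≤ k * (k + 1) := by
    rcases le_or_gt 0 k with h | h
    · positivity
    · nlinarith
  have h' : (0 : ℝ) ≤ k * (k + 1) := by exact_mod_cast this
  nlinarith

lemma charCovector_inner_unit {U : Submodule ℤ E} {w e : E} (hw : w ∈ charCovectors U) (he : e ∈ U)
    (h1 : ‖e‖ = 1) : ∃ k : ℤ, ⟪w, e⟫ = 2 * k + 1 := by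
  obtain ⟨k, hk⟩ := hw.2 e he
  rw [real_inner_self_eq_norm_sq, h1] at hk
  exact ⟨k, by linarith⟩

lemma sum_mem_charCovectors (e : OrthonormalBasis ι ℝ E) :
    ∑ i, e i ∈ charCovectors (Submodule.span ℤ (Set.range e)) := by
  refine ⟨?_, fun v hv => ?_⟩
  · rw [isUnimodular_span_orthonormalBasis e]
    exact Submodule.sum_mem _ fun i _ => Submodule.subset_span ⟨i, rfl⟩
  · choose k hk using (mem_span_orthonormalBasis e).1 hv
    choose l hl using fun i => Int.even_mul_pred_self (k i)
    refine ⟨-∑ i, l i, ?_⟩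
    rw [sum_inner, ← e.sum_inner_mul_inner v v, ← Finset.sum_sub_distrib]
    push_cast
    rw [← Finset.sum_neg_distrib, Finset.mul_sum]
    refine Finset.sum_congr rfl fun i _ => ?_
    rw [real_inner_comm (e i) v, hk]
    have : (k i : ℝ) * (k i - 1) = l i + l i := by exact_mod_cast hl i
    linarith

lemma norm_sq_sum_orthonormalBasis (e : OrthonormalBasis ι ℝ E) :
    ‖∑ i, e i‖ ^ 2 = Fintype.card ι := by
  have := e.orthonormal.inner_sum (fun _ => (1 : ℝ)) (fun _ => 1) Finset.univ
  simp only [one_smul] at this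
  rw [← real_inner_self_eq_norm_sq, this]
  simp

end StandardLattice

/-- **van der Blij**: the norm of a characteristic covector of a unimodular lattice is congruent to
the rank modulo `8`. -/
theorem IsUnimodular.norm_sq_charCovector {E : Type*} [NormedAddCommGroup E]
    [InnerProductSpace ℝ E] [FiniteDimensional ℝ E] {U : Submodule ℤ E} (hU : IsUnimodular U)
    {w : E} (hw : w ∈ charCovectors U) : ∃ k : ℤ, ‖w‖ ^ 2 - finrank ℝ E = 8 * (k : ℝ) := by
  let e := stdOrthonormalBasis ℝ E
  have h1 := cexp_norm_sq_charCovector hU hw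
  -- The standard lattice of the same rank has the same multiplier, and its characteristic covector
  -- (1, …, 1) has norm equal to the rank. Equality of the values e^(πi·/4) is congruence modulo 8.
  have h2 := cexp_norm_sq_charCovector (isUnimodular_span_orthonormalBasis e)
    (sum_mem_charCovectors e)
  rw [← h2, norm_sq_sum_orthonormalBasis, Fintype.card_fin,
    Complex.exp_eq_exp_iff_exists_int] at h1
  obtain ⟨k, hk⟩ := h1
  refine ⟨k, ?_⟩
  have hpi : (Real.pi * I : ℂ) ≠ 0 := by simp [Real.pi_ne_zero]
  have h3 : ((‖w‖ ^ 2 / 4 : ℝ) : ℂ) = ((finrank ℝ E / 4 + 2 * k : ℝ) : ℂ) := by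
    refine mul_left_cancel₀ hpi ?_
    rw [hk]
    push_cast
    ring
  have h4 := ofReal_injective h3
  linarith

end

/-! ### A vanishing criterion for level-one forms. -/

noncomputable section

section LevelOne

open UpperHalfPlane ModularForm SlashInvariantForm ModularFormClass MatrixGroups OnePoint Filter
  Asymptotics

open scoped Manifold

lemma coe_S_smul (z : ℍ) : ((ModularGroup.S • z : ℍ) : ℂ) = -1 / z := by
  rw [UpperHalfPlane.modular_S_smul]
  simp [neg_div, inv_neg]

lemma coe_T_smul (z : ℍ) : ((ModularGroup.T • z : ℍ) : ℂ) = z + 1 := by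
  rw [UpperHalfPlane.modular_T_smul]
  simp [add_comm]

lemma denom_T_eq (z : ℍ) : denom ModularGroup.T z = 1 := by
  rw [ModularGroup.denom_apply]
  simp [ModularGroup.T]

lemma discriminant_S_smul (z : ℍ) :
    discriminant (ModularGroup.S • z) = (z : ℂ) ^ 12 * discriminant z := by
  have h := congrFun discriminant_S_invariant z
  rw [SL_slash_apply, ModularGroup.denom_S] at h
  have h12 : (z : ℂ) ^ (-12 : ℤ) = ((z : ℂ) ^ 12)⁻¹ := by
    rw [zpow_neg]
    rfl
  rw [h12] at h
  rw [← h, mul_comm, mul_assoc, inv_mul_cancel₀ (pow_ne_zero _ z.ne_zero), mul_one]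

lemma discriminant_T_smul (z : ℍ) : discriminant (ModularGroup.T • z) = discriminant z := by
  have h := congrFun discriminant_T_invariant z
  rw [SL_slash_apply, denom_T_eq, one_zpow, mul_one] at h
  exact h

/-- A holomorphic function on the upper half plane that transforms like a modular form of weight
`12 m` and level one and vanishes at infinity to order greater than `m` is zero. -/
theorem eq_zero_of_levelOne_of_decay (m : ℕ) (F : ℂ → ℂ)
    (hd : DifferentiableOn ℂ F {τ | 0 < τ.im}) (hT : ∀ τ : ℂ, 0 < τ.im → F (τ + 1) = F τ)
    (hS : ∀ τ : ℂ, 0 < τ.im → F (-1 / τ) = τ ^ (12 * m) * F τ)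
    (hb : ∃ C : ℝ, ∀ τ : ℂ, 1 ≤ τ.im →
      ‖F τ‖ ≤ C * Real.exp (-2 * Real.pi * τ.im) ^ (m + 1)) :
    ∀ τ : ℂ, 0 < τ.im → F τ = 0 := by
  have hΔ : MDiff (discriminant : ℍ → ℂ) := CuspForm.discriminant.holo'
  -- The discriminant has weight 12, no zeros in the half plane and a simple zero at infinity. The
  -- quotient is thus a level-one form of weight 12m - 12(m + 1) = -12, bounded at infinity, hence
  -- zero.
  set f : ℍ → ℂ := fun z => F z / discriminant z ^ (m + 1) with hf
  have hfT : f ∣[(-12 : ℤ)] ModularGroup.T = f := by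
    ext z
    rw [SL_slash_apply, denom_T_eq, one_zpow, mul_one]
    simp only [hf]
    rw [coe_T_smul, hT z z.2, discriminant_T_smul]
  have hfS : f ∣[(-12 : ℤ)] ModularGroup.S = f := by
    ext z
    rw [SL_slash_apply, ModularGroup.denom_S]
    simp only [hf]
    rw [coe_S_smul, hS z z.2, discriminant_S_smul, neg_neg]
    have hz : (z : ℂ) ≠ 0 := z.ne_zero
    have hΔz := discriminant_ne_zero z
    rw [show (z : ℂ) ^ (12 : ℤ) = (z : ℂ) ^ 12 from rfl]
    field_simp
    ring
  have hinv := slash_action_generators_SL2Z hfS hfT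
  have hbdd : IsBoundedAtImInfty f := by
    obtain ⟨C, hC⟩ := hb
    have h1 : (fun z : ℍ => F z) =O[atImInfty]
        fun z : ℍ => Real.exp (-2 * Real.pi * z.im) ^ (m + 1) := by
      refine IsBigO.of_bound C ?_
      have : ∀ᶠ z : ℍ in atImInfty, 1 ≤ z.im := atImInfty_mem _ |>.2 ⟨1, fun z hz => hz⟩
      filter_upwards [this] with z hz
      refine (hC z hz).trans (le_of_eq ?_)
      rw [Real.norm_of_nonneg (by positivity)]
      rfl
    have h2 := h1.trans (exp_isBigO_discriminant.pow (m + 1))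
    exact (div_isBoundedUnder_of_isBigO h2).isBigO_one ℝ
  let M : ModularForm 𝒮ℒ (-12) :=
    { toFun := f
      slash_action_eq' := fun _ ⟨γ, hγ⟩ => hγ ▸ hinv γ
      holo' := by
        refine MDifferentiable.div ?_ (hΔ.pow (m + 1)) fun z => pow_ne_zero _ (discriminant_ne_zero z)
        rw [UpperHalfPlane.mdifferentiable_iff]
        refine hd.congr fun z hz => ?_
        simp [ofComplex_apply_of_im_pos hz]
      bdd_at_cusps' := fun {c} hc => by
        rw [Subgroup.IsArithmetic.isCusp_iff_isCusp_SL2Z] at hc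
        rw [isBoundedAt_iff_forall_SL2Z hc]
        intro γ _
        rw [hinv γ]
        exact hbdd }
  have hM : (M : ℍ → ℂ) = 0 := levelOne_neg_weight_eq_zero (by norm_num) M
  intro τ hτ
  have h := congrFun hM ⟨τ, hτ⟩
  have h' : F τ / discriminant ⟨τ, hτ⟩ ^ (m + 1) = 0 := h
  exact (div_eq_zero_iff.1 h').resolve_right (pow_ne_zero _ (discriminant_ne_zero _))

end LevelOne

end

/-! ### Comparison with the standard lattice and Elkies' theorem. -/

noncomputable section

open Complex Module

/-- A triple of holomorphic functions with the transformation behaviour of the three theta series of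
a unimodular lattice of rank `m` vanishes if it decays fast enough at infinity. -/
lemma eq_zero_of_theta_transformation (m : ℕ) {h2 h3 h4 : ℂ → ℂ} {ζ : ℂ}
    (h2d : DifferentiableOn ℂ h2 {τ | 0 < τ.im}) (h3d : DifferentiableOn ℂ h3 {τ | 0 < τ.im})
    (h4d : DifferentiableOn ℂ h4 {τ | 0 < τ.im}) (hζ8 : ζ ^ 8 = 1)
    (h2T : ∀ τ, h2 (τ + 1) = ζ * h2 τ) (h3T : ∀ τ, h3 (τ + 1) = h4 τ)
    (h4T : ∀ τ, h4 (τ + 1) = h3 τ)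
    (h2S : ∀ τ : ℂ, 0 < τ.im → h2 τ = thetaFactor m τ * h4 (-1 / τ))
    (h3S : ∀ τ : ℂ, 0 < τ.im → h3 τ = thetaFactor m τ * h3 (-1 / τ))
    (h4S : ∀ τ : ℂ, 0 < τ.im → h4 τ = thetaFactor m τ * h2 (-1 / τ))
    (hb2 : ∃ C : ℝ, 0 ≤ C ∧ ∀ τ : ℂ, 1 ≤ τ.im →
      ‖h2 τ‖ ≤ C * Real.exp (-(Real.pi * (m / 4)) * τ.im))
    (hb3 : ∃ C : ℝ, 0 ≤ C ∧ ∀ τ : ℂ, 1 ≤ τ.im → ‖h3 τ‖ ≤ C * Real.exp (-Real.pi * τ.im))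
    (hb4 : ∃ C : ℝ, 0 ≤ C ∧ ∀ τ : ℂ, 1 ≤ τ.im → ‖h4 τ‖ ≤ C * Real.exp (-Real.pi * τ.im)) :
    ∀ τ : ℂ, 0 < τ.im → h3 τ = 0 := by
  obtain ⟨C2, hC2, hb2⟩ := hb2
  obtain ⟨C3, hC3, hb3⟩ := hb3
  obtain ⟨C4, hC4, hb4⟩ := hb4
  -- Translation swaps h3 and h4 and inversion swaps h2 and h4, so the product is preserved up to
  -- factors; the eighth power removes ζ. The decay exponent is 8π(m/4 + 1 + 1) = 2π(m + 8), more
  -- than the required 2π(m + 1).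
  have hF := eq_zero_of_levelOne_of_decay m (fun τ => (h2 τ * h3 τ * h4 τ) ^ 8)
    (((h2d.mul h3d).mul h4d).pow 8)
    (fun τ _ => by
      simp only [h2T, h3T, h4T]
      rw [show ζ * h2 τ * h4 τ * h3 τ = ζ * (h2 τ * h3 τ * h4 τ) by ring, mul_pow, hζ8, one_mul])
    (fun τ hτ => by
      have hτ0 : τ ≠ 0 := by
        rintro rfl
        simp at hτ
      simp only [h2S τ hτ, h3S τ hτ, h4S τ hτ]
      linear_combination (-(h2 (-1 / τ) * h3 (-1 / τ) * h4 (-1 / τ)) ^ 8) * thetaFactor_pow m hτ0)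
    ⟨(C2 * C3 * C4) ^ 8, fun τ hτ => by
      rw [norm_pow, norm_mul, norm_mul]
      calc (‖h2 τ‖ * ‖h3 τ‖ * ‖h4 τ‖) ^ 8
          ≤ ((C2 * Real.exp (-(Real.pi * (m / 4)) * τ.im)) * (C3 * Real.exp (-Real.pi * τ.im)) *
            (C4 * Real.exp (-Real.pi * τ.im))) ^ 8 := by
            gcongr
            · exact hb2 τ hτ
            · exact hb3 τ hτ
            · exact hb4 τ hτ
        _ = (C2 * C3 * C4) ^ 8 *
            Real.exp ((8 : ℕ) * (-(Real.pi * (m / 4)) * τ.im + -Real.pi * τ.im + -Real.pi * τ.im)) := by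
            rw [Real.exp_nat_mul, Real.exp_add, Real.exp_add]
            ring
        _ ≤ _ := by
            rw [← Real.exp_nat_mul]
            refine mul_le_mul_of_nonneg_left (Real.exp_le_exp.2 ?_) (by positivity)
            push_cast
            nlinarith [Real.pi_pos, mul_pos Real.pi_pos (show 0 < τ.im by linarith)]⟩
  have hopen : IsOpen {τ : ℂ | 0 < τ.im} := isOpen_lt continuous_const continuous_im
  have hconn : IsPreconnected {τ : ℂ | 0 < τ.im} := (convex_halfSpace_im_gt 0).isPreconnected
  have hprod : ∀ τ ∈ {τ : ℂ | 0 < τ.im}, h2 τ * h3 τ * h4 τ = 0 := fun τ hτ =>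
    pow_eq_zero_iff (by norm_num) |>.1 (hF τ hτ)
  -- By analyticity one of the three factors vanishes identically, and the transformation laws carry
  -- its vanishing to h3.
  have h4zero : (∀ τ : ℂ, 0 < τ.im → h4 τ = 0) → ∀ τ : ℂ, 0 < τ.im → h3 τ = 0 := by
    intro h τ hτ
    rw [← h4T]
    exact h _ (by simpa using hτ)
  rcases AnalyticOnNhd.eq_zero_or_eq_zero_of_mul_eq_zero
    (f := fun τ => h2 τ * h3 τ) ((h2d.mul h3d).analyticOnNhd hopen)
    (h4d.analyticOnNhd hopen) hprod hconn with h | h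
  · rcases AnalyticOnNhd.eq_zero_or_eq_zero_of_mul_eq_zero (h2d.analyticOnNhd hopen)
      (h3d.analyticOnNhd hopen) h hconn with h | h
    · refine h4zero fun τ hτ => ?_
      rw [h4S τ hτ, h _ (neg_one_div_im_pos hτ), mul_zero]
    · exact h
  · exact h4zero h

section Comparison

variable {E : Type*} [NormedAddCommGroup E] [InnerProductSpace ℝ E] [FiniteDimensional ℝ E]

lemma thetaSeries_eq_add {U : Submodule ℤ E} [DiscreteTopology U] [DecidableEq U] {c : U → ℂ}
    (hc : ∀ v, ‖c v‖ ≤ 1) {τ : ℂ} (hτ : 0 < τ.im) :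
    thetaSeries U c 0 τ = c 0 + thetaSeries U (fun v => if v = 0 then 0 else c v) 0 τ := by
  rw [thetaSeries, (summable_thetaSeries hc 0 hτ).tsum_eq_add_tsum_ite 0, thetaSeries]
  congr 1
  · simp
  · refine tsum_congr fun v => ?_
    split_ifs <;> simp

/-- The difference of two theta series with the same constant term is `O(exp (-π Im τ))`. -/
lemma exists_norm_thetaSeries_sub_le {U V : Submodule ℤ E} (hU : IsUnimodular U)
    (hV : IsUnimodular V) {c : U → ℂ} (hc : ∀ v, ‖c v‖ ≤ 1) {d : V → ℂ} (hd : ∀ v, ‖d v‖ ≤ 1)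
    (h0 : c 0 = d 0) : ∃ C : ℝ, 0 ≤ C ∧ ∀ τ : ℂ, 1 ≤ τ.im →
      ‖thetaSeries U c 0 τ - thetaSeries V d 0 τ‖ ≤ C * Real.exp (-Real.pi * τ.im) := by
  classical
  have := hU.discreteTopology
  have := hV.discreteTopology
  obtain ⟨C, hC0, hC⟩ := exists_norm_thetaSeries_le (U := U) (μ := 1)
    (c := fun v => if v = 0 then 0 else c v) (fun v => by split_ifs <;> simp [hc]) 0
    (fun v hv => by
      rw [add_zero]
      exact hU.one_le_norm v.2 fun h => hv (by simp [Subtype.ext_iff, h]))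
  obtain ⟨D, hD0, hD⟩ := exists_norm_thetaSeries_le (U := V) (μ := 1)
    (c := fun v => if v = 0 then 0 else d v) (fun v => by split_ifs <;> simp [hd]) 0
    (fun v hv => by
      rw [add_zero]
      exact hV.one_le_norm v.2 fun h => hv (by simp [Subtype.ext_iff, h]))
  refine ⟨C + D, add_nonneg hC0 hD0, fun τ hτ => ?_⟩
  rw [thetaSeries_eq_add hc (by linarith), thetaSeries_eq_add hd (by linarith), h0,
    add_sub_add_left_eq_sub, add_mul]
  refine (norm_sub_le _ _).trans (add_le_add ?_ ?_)
  · simpa using hC τ hτ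
  · simpa using hD τ hτ

omit [FiniteDimensional ℝ E] in
lemma add_two_smul_mem_charCovectors {U : Submodule ℤ E} (hU : IsUnimodular U) {w v : E}
    (hw : w ∈ charCovectors U) (hv : v ∈ U) : w + (2 : ℝ) • v ∈ charCovectors U := by
  have h2 : (2 : ℝ) • v ∈ U := by
    rw [two_smul]
    exact add_mem hv hv
  refine ⟨add_mem hw.1 (hU.symm ▸ h2), fun x hx => ?_⟩
  obtain ⟨k, hk⟩ := hw.2 x hx
  obtain ⟨l, hl⟩ := hU.integral hv hx
  refine ⟨k + l, ?_⟩
  rw [inner_add_left, real_inner_smul_left, hl]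
  push_cast
  linarith

/-- The vectors v + w/2 are halves of the characteristic covectors w + 2v, so the exponents are at
least μ/4. -/
lemma exists_norm_theta2_le {U : Submodule ℤ E} (hU : IsUnimodular U) {μ : ℝ}
    (hmin : ∀ w ∈ charCovectors U, μ ≤ ‖w‖ ^ 2) {w : E} (hw : w ∈ charCovectors U) :
    ∃ C : ℝ, 0 ≤ C ∧ ∀ τ : ℂ, 1 ≤ τ.im →
      ‖theta2 U w τ‖ ≤ C * Real.exp (-(Real.pi * (μ / 4)) * τ.im) := by
  have := hU.discreteTopology
  refine exists_norm_thetaSeries_le (by simp) _ fun v _ => ?_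
  have h := hmin _ (add_two_smul_mem_charCovectors hU hw v.2)
  have h2 : w + (2 : ℝ) • (v : E) = (2 : ℝ) • ((v : E) + (1 / 2 : ℝ) • w) := by
    module
  rw [h2, norm_smul, mul_pow, Real.norm_eq_abs, sq_abs] at h
  linarith

variable {U V : Submodule ℤ E}

/-- Two unimodular lattices in the same space whose characteristic covectors are all at least as
long as those of the standard lattice have the same theta series. -/
theorem theta3_eq_of_charCovectors_norm (hU : IsUnimodular U) (hV : IsUnimodular V)
    (hUmin : ∀ w ∈ charCovectors U, (finrank ℝ E : ℝ) ≤ ‖w‖ ^ 2)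
    (hVmin : ∀ w ∈ charCovectors V, (finrank ℝ E : ℝ) ≤ ‖w‖ ^ 2) {τ : ℂ} (hτ : 0 < τ.im) :
    theta3 U τ = theta3 V τ := by
  have := hU.discreteTopology
  have := hV.discreteTopology
  obtain ⟨w, hw⟩ := hU.exists_charCovector
  obtain ⟨x, hx⟩ := hV.exists_charCovector
  set m := finrank ℝ E with hm
  set h3 : ℂ → ℂ := fun τ => theta3 U τ - theta3 V τ with hh3
  set h4 : ℂ → ℂ := fun τ => theta4 U w τ - theta4 V x τ with hh4
  set h2 : ℂ → ℂ := fun τ => theta2 U w τ - theta2 V x τ with hh2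
  set ζ := cexp (Real.pi * I * (‖w‖ ^ 2 / 4 : ℝ)) with hζ
  -- The multiplier depends only on the rank; otherwise the difference h2 would have no
  -- transformation law under translation.
  have hζx : cexp (Real.pi * I * (‖x‖ ^ 2 / 4 : ℝ)) = ζ := by
    rw [hζ, cexp_norm_sq_charCovector hU hw, cexp_norm_sq_charCovector hV hx]
  have hζ8 : ζ ^ 8 = 1 := by
    obtain ⟨k, hk⟩ := hU.norm_sq_charCovector hw
    rw [hζ, ← Complex.exp_nat_mul, Complex.exp_eq_one_iff]
    refine ⟨m + 8 * k, ?_⟩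
    rw [show ‖w‖ ^ 2 = m + 8 * k by linarith]
    push_cast
    ring
  have h3T : ∀ τ, h3 (τ + 1) = h4 τ := fun τ => by
    simp only [hh3, hh4]
    rw [theta3_add_one hw, theta3_add_one hx]
  have h4T : ∀ τ, h4 (τ + 1) = h3 τ := fun τ => by
    simp only [hh3, hh4]
    rw [theta4_add_one hw, theta4_add_one hx]
  have h2T : ∀ τ, h2 (τ + 1) = ζ * h2 τ := fun τ => by
    simp only [hh2]
    rw [theta2_add_one hU hw, theta2_add_one hV hx, hζx, mul_sub]
  have h3S : ∀ τ : ℂ, 0 < τ.im → h3 τ = thetaFactor m τ * h3 (-1 / τ) := fun τ hτ => by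
    simp only [hh3]
    rw [theta3_inversion hU hτ, theta3_inversion hV hτ, mul_sub]
  have h4S : ∀ τ : ℂ, 0 < τ.im → h4 τ = thetaFactor m τ * h2 (-1 / τ) := fun τ hτ => by
    simp only [hh4, hh2]
    rw [theta4_inversion hU w hτ, theta4_inversion hV x hτ, mul_sub]
  have h2S : ∀ τ : ℂ, 0 < τ.im → h2 τ = thetaFactor m τ * h4 (-1 / τ) := fun τ hτ => by
    simp only [hh4, hh2]
    rw [theta2_inversion hU w hτ, theta2_inversion hV x hτ, mul_sub]
  have h3d : DifferentiableOn ℂ h3 {τ | 0 < τ.im} :=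
    (differentiableOn_thetaSeries (by simp) 0).sub (differentiableOn_thetaSeries (by simp) 0)
  have h2d : DifferentiableOn ℂ h2 {τ | 0 < τ.im} :=
    (differentiableOn_thetaSeries (by simp) _).sub (differentiableOn_thetaSeries (by simp) _)
  have h4d : DifferentiableOn ℂ h4 {τ | 0 < τ.im} :=
    (differentiableOn_thetaSeries (fun v => norm_thetaCharacter _ _) 0).sub
      (differentiableOn_thetaSeries (fun v => norm_thetaCharacter _ _) 0)
  obtain ⟨C3, hC3, hb3⟩ : ∃ C : ℝ, 0 ≤ C ∧ ∀ τ : ℂ, 1 ≤ τ.im →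
      ‖h3 τ‖ ≤ C * Real.exp (-Real.pi * τ.im) :=
    exists_norm_thetaSeries_sub_le hU hV (by simp) (by simp) rfl
  obtain ⟨C4, hC4, hb4⟩ : ∃ C : ℝ, 0 ≤ C ∧ ∀ τ : ℂ, 1 ≤ τ.im →
      ‖h4 τ‖ ≤ C * Real.exp (-Real.pi * τ.im) :=
    exists_norm_thetaSeries_sub_le hU hV (fun v => norm_thetaCharacter _ _)
      (fun v => norm_thetaCharacter _ _) (by simp)
  obtain ⟨C2, hC2, hb2⟩ : ∃ C : ℝ, 0 ≤ C ∧ ∀ τ : ℂ, 1 ≤ τ.im →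
      ‖h2 τ‖ ≤ C * Real.exp (-(Real.pi * (m / 4)) * τ.im) := by
    obtain ⟨C, hC, hbC⟩ := exists_norm_theta2_le hU hUmin hw
    obtain ⟨D, hD, hbD⟩ := exists_norm_theta2_le hV hVmin hx
    refine ⟨C + D, add_nonneg hC hD, fun τ hτ => ?_⟩
    rw [add_mul]
    exact (norm_sub_le _ _).trans (add_le_add (hbC τ hτ) (hbD τ hτ))
  exact sub_eq_zero.1 (eq_zero_of_theta_transformation m h2d h3d h4d hζ8 h2T h3T h4T h2S h3S h4S
    ⟨C2, hC2, hb2⟩ ⟨C3, hC3, hb3⟩ ⟨C4, hC4, hb4⟩ τ hτ)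

end Comparison

section UnitVectors

variable {E : Type*} [NormedAddCommGroup E] [InnerProductSpace ℝ E]

/-- The vectors of norm one in a lattice. -/
def unitVectors (U : Submodule ℤ E) : Set E := {v | v ∈ U ∧ ‖v‖ = 1}

/-- Unit vectors in an integral lattice are equal, opposite or orthogonal. -/
lemma IsUnimodular.inner_unitVectors {U : Submodule ℤ E} (hU : IsUnimodular U) {v w : E}
    (hv : v ∈ unitVectors U) (hw : w ∈ unitVectors U) : v = w ∨ v = -w ∨ ⟪v, w⟫ = 0 := by
  obtain ⟨k, hk⟩ := hU.integral hv.1 hw.1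
  have h1 : |⟪v, w⟫| ≤ 1 := by simpa [hv.2, hw.2] using abs_real_inner_le_norm v w
  rw [hk] at h1
  have h2 : |k| ≤ 1 := by exact_mod_cast h1
  have h3 : k = 1 ∨ k = -1 ∨ k = 0 := by
    rw [abs_le] at h2
    omega
  rcases h3 with rfl | rfl | rfl
  · left
    exact (inner_eq_one_iff_of_norm_eq_one (𝕜 := ℝ) hv.2 hw.2).1 (by simpa using hk)
  · right; left
    refine (inner_eq_one_iff_of_norm_eq_one (𝕜 := ℝ) hv.2 (by simpa using hw.2)).1 ?_
    rw [inner_neg_right, hk]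
    simp
  · right; right
    simpa using hk

variable [FiniteDimensional ℝ E]

lemma IsUnimodular.finite_unitVectors {U : Submodule ℤ E} (hU : IsUnimodular U) :
    (unitVectors U).Finite := by
  have := hU.discreteTopology
  have := (summable_exp_neg_norm_sq U one_pos (0 : E)).tendsto_cofinite_zero
  have hev := this.eventually (gt_mem_nhds (Real.exp_pos (-1)))
  rw [Filter.eventually_cofinite] at hev
  refine (hev.image Subtype.val).subset fun v hv => ⟨⟨v, hv.1⟩, ?_, rfl⟩
  simp [hv.2]

/-- The number of unit vectors of a unimodular lattice is determined by its theta series. -/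
lemma IsUnimodular.tendsto_thetaSeries {U : Submodule ℤ E} (hU : IsUnimodular U) :
    Filter.Tendsto (fun t : ℝ => Real.exp (Real.pi * t) *
      (∑' v : U, Real.exp (-(Real.pi * t) * ‖(v : E) + 0‖ ^ 2) - 1)) Filter.atTop
      (nhds ((unitVectors U).ncard : ℝ)) := by
  classical
  have := hU.discreteTopology
  have hfin : {v : U | ‖(v : E)‖ = 1}.Finite :=
    Set.Finite.of_finite_image (hU.finite_unitVectors.subset (by
      rintro _ ⟨v, hv, rfl⟩
      exact ⟨v.2, hv⟩)) Subtype.val_injective.injOn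
  have hlim : ∑' v : U, (if ‖(v : E)‖ = 1 then (1 : ℝ) else 0) = (unitVectors U).ncard := by
    rw [tsum_eq_sum (s := hfin.toFinset) (fun v hv => if_neg (by simpa using hv)),
      Finset.sum_ite_of_true (by simp), Finset.sum_const, nsmul_eq_mul, mul_one,
      ← Set.ncard_eq_toFinset_card _ hfin]
    congr 1
    rw [← Set.ncard_image_of_injective _ Subtype.val_injective]
    congr 1
    ext v
    simp [unitVectors, and_comm]
  rw [← hlim]
  -- For v ≠ 0 the terms e^(-πt(‖v‖² - 1)) with t ≥ 1 are dominated by their values at t = 1; in the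
  -- limit only the unit vectors survive.
  have hs := (summable_exp_neg_norm_sq U Real.pi_pos (0 : E)).mul_left (Real.exp Real.pi)
  have hmain := tendsto_tsum_of_dominated_convergence (𝓕 := Filter.atTop)
    (f := fun (t : ℝ) (v : U) => if v = 0 then (0 : ℝ) else
      Real.exp (-(Real.pi * t) * (‖(v : E)‖ ^ 2 - 1)))
    (g := fun v : U => if ‖(v : E)‖ = 1 then (1 : ℝ) else 0) hs ?_ ?_
  · refine hmain.congr' ?_
    filter_upwards [Filter.eventually_gt_atTop 0] with t ht
    rw [(summable_exp_neg_norm_sq U (a := Real.pi * t) (by positivity) 0).tsum_eq_add_tsum_ite 0]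
    simp only [ZeroMemClass.coe_zero, add_zero, norm_zero]
    rw [show -(Real.pi * t) * (0 : ℝ) ^ 2 = 0 by ring, Real.exp_zero, add_sub_cancel_left,
      ← tsum_mul_left]
    refine tsum_congr fun v => ?_
    split_ifs
    · simp
    · rw [← Real.exp_add]
      congr 1
      ring
  · intro v
    by_cases hv0 : v = 0
    · simp [hv0]
    simp only [if_neg hv0]
    by_cases hv1 : ‖(v : E)‖ = 1
    · simp [hv1]
    simp only [if_neg hv1]
    have h1 := hU.one_le_norm v.2 (by simpa using hv0)
    have h2 : 0 < ‖(v : E)‖ ^ 2 - 1 := by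
      rcases h1.lt_or_eq with h | h
      · linarith
      · exact absurd ((pow_eq_one_iff_of_nonneg (norm_nonneg _) two_ne_zero).1 h.symm) hv1
    refine Real.tendsto_exp_atBot.comp ?_
    have h3 : Filter.Tendsto (fun t : ℝ => (Real.pi * (‖(v : E)‖ ^ 2 - 1)) * t) Filter.atTop
      Filter.atTop := Filter.tendsto_id.const_mul_atTop (by positivity)
    refine (Filter.tendsto_neg_atTop_atBot.comp h3).congr fun t => ?_
    simp only [Function.comp]
    ring
  · filter_upwards [Filter.eventually_ge_atTop 1] with t ht v
    by_cases hv0 : v = 0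
    · simp only [hv0, if_true, norm_zero]
      positivity
    simp only [if_neg hv0, add_zero]
    rw [Real.norm_eq_abs, Real.abs_exp, ← Real.exp_add, Real.exp_le_exp]
    have h1 := hU.one_le_norm v.2 (by simpa using hv0)
    nlinarith [mul_nonneg (mul_nonneg Real.pi_pos.le (sub_nonneg.2 ht)) (sub_nonneg.2 h1)]

lemma two_mul_card_le_ncard_unitVectors {ι : Type*} [Fintype ι] (e : OrthonormalBasis ι ℝ E) :
    2 * Fintype.card ι ≤ (unitVectors (Submodule.span ℤ (Set.range e))).ncard := by
  have hfin := (isUnimodular_span_orthonormalBasis e).finite_unitVectors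
  let f : ι × Bool → E := fun p => if p.2 then e p.1 else -e p.1
  have hf : Function.Injective f := by
    have hne : ∀ i j, e i ≠ -e j := by
      intro i j h
      have h1 := congrArg (fun x => ⟪e j, x⟫) h
      simp only [inner_neg_right, real_inner_self_eq_norm_sq, e.norm_eq_one] at h1
      classical
      rw [e.inner_eq_ite] at h1
      split_ifs at h1 <;> norm_num at h1
    rintro ⟨i, a⟩ ⟨j, b⟩ h
    cases a <;> cases b <;> simp only [f, if_true, if_false, Bool.false_eq_true, neg_inj] at h
    · rw [e.orthonormal.linearIndependent.injective h]
    · exact absurd h.symm (hne _ _)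
    · exact absurd h (hne _ _)
    · rw [e.orthonormal.linearIndependent.injective h]
  have hsub : Set.range f ⊆ unitVectors (Submodule.span ℤ (Set.range e)) := by
    rintro _ ⟨⟨i, a⟩, rfl⟩
    have hi : e i ∈ Submodule.span ℤ (Set.range e) := Submodule.subset_span ⟨i, rfl⟩
    cases a
    · exact ⟨by simpa [f] using hi, by simp [f]⟩
    · exact ⟨by simpa [f] using hi, by simp [f]⟩
  have h1 := Set.ncard_le_ncard hsub hfin
  rw [← Set.image_univ, Set.ncard_image_of_injective _ hf, Set.ncard_univ, Nat.card_eq_fintype_card,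
    Fintype.card_prod, Fintype.card_bool] at h1
  linarith

/-- A unimodular lattice with at least `2 m` unit vectors, `m` its rank, contains an orthonormal
basis. -/
lemma IsUnimodular.exists_orthonormalBasis_of_ncard {U : Submodule ℤ E} (hU : IsUnimodular U)
    (h : 2 * finrank ℝ E ≤ (unitVectors U).ncard) :
    ∃ e : OrthonormalBasis (Fin (finrank ℝ E)) ℝ E, ∀ i, e i ∈ U := by
  classical
  have hfin := hU.finite_unitVectors
  set S := hfin.toFinset with hS
  have hmemS : ∀ v, v ∈ S ↔ v ∈ unitVectors U := fun v => by simp [hS]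
  -- A largest set A of pairwise orthogonal unit vectors meets every pair ±v, so there are at most
  -- 2|A| unit vectors and A has at least as many elements as the rank.
  obtain ⟨A, hA, hmax⟩ := Finset.exists_max_image
    (S.powerset.filter fun A => ∀ v ∈ A, ∀ w ∈ A, v ≠ w → ⟪v, w⟫ = 0) Finset.card
    ⟨∅, by simp⟩
  simp only [Finset.mem_filter, Finset.mem_powerset] at hA hmax
  have hcover : S ⊆ A ∪ A.image (fun v => -v) := by
    intro v hv
    by_contra hnot
    simp only [Finset.mem_union, Finset.mem_image, not_or, not_exists, not_and] at hnot
    have horth : ∀ w ∈ A, ⟪v, w⟫ = 0 := by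
      intro w hw
      rcases hU.inner_unitVectors ((hmemS v).1 hv) ((hmemS w).1 (hA.1 hw)) with h | h | h
      · exact absurd (h ▸ hw) hnot.1
      · exact absurd h.symm (hnot.2 w hw)
      · exact h
    have := hmax (insert v A) ⟨Finset.insert_subset hv hA.1, by
      intro x hx y hy hxy
      rw [Finset.mem_insert] at hx hy
      rcases hx with rfl | hx <;> rcases hy with rfl | hy
      · exact absurd rfl hxy
      · exact horth y hy
      · rw [real_inner_comm]
        exact horth x hx
      · exact hA.2 x hx y hy hxy⟩
    rw [Finset.card_insert_of_notMem hnot.1] at this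
    omega
  have hcard : S.card ≤ 2 * A.card := by
    refine (Finset.card_le_card hcover).trans ((Finset.card_union_le _ _).trans ?_)
    have := Finset.card_image_le (s := A) (f := fun v => -v)
    omega
  rw [Set.ncard_eq_toFinset_card _ hfin, ← hS] at h
  have horth : Orthonormal ℝ (fun v : A => (v : E)) :=
    ⟨fun v => ((hmemS v).1 (hA.1 v.2)).2, fun v w hvw =>
      hA.2 v v.2 w w.2 fun h => hvw (Subtype.ext h)⟩
  have hle : A.card ≤ finrank ℝ E := by
    simpa using horth.linearIndependent.fintype_card_le_finrank
  have heq : Fintype.card A = finrank ℝ E := by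
    rw [Fintype.card_coe]
    omega
  let e := OrthonormalBasis.mk horth
    (horth.linearIndependent.span_eq_top_of_card_eq_finrank' heq).ge
  refine ⟨e.reindex (Fintype.equivFinOfCardEq heq), fun i => ?_⟩
  rw [OrthonormalBasis.reindex_apply, OrthonormalBasis.coe_mk]
  exact ((hmemS _).1 (hA.1 (Subtype.prop _))).1

/-- **Elkies**: a unimodular lattice none of whose characteristic covectors is shorter than those
of the standard lattice contains an orthonormal basis. -/
theorem IsUnimodular.exists_orthonormalBasis {U : Submodule ℤ E} (hU : IsUnimodular U)
    (hmin : ∀ w ∈ charCovectors U, (finrank ℝ E : ℝ) ≤ ‖w‖ ^ 2) :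
    ∃ e : OrthonormalBasis (Fin (finrank ℝ E)) ℝ E, ∀ i, e i ∈ U := by
  let e := stdOrthonormalBasis ℝ E
  have hV := isUnimodular_span_orthonormalBasis e
  have hVmin : ∀ w ∈ charCovectors (Submodule.span ℤ (Set.range e)),
      (finrank ℝ E : ℝ) ≤ ‖w‖ ^ 2 := fun w hw => by
    simpa using card_le_norm_sq_of_odd e.orthonormal fun i =>
      charCovector_inner_unit hw (Submodule.subset_span ⟨i, rfl⟩) (e.norm_eq_one i)
  refine hU.exists_orthonormalBasis_of_ncard ?_
  have hcard : (unitVectors U).ncard =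
      (unitVectors (Submodule.span ℤ (Set.range e))).ncard := by
    have h1 := hU.tendsto_thetaSeries
    have h2 := hV.tendsto_thetaSeries
    refine Nat.cast_injective (R := ℝ) (tendsto_nhds_unique (h1.congr' ?_) h2)
    filter_upwards [Filter.eventually_gt_atTop 0] with t ht
    have h3 := theta3_eq_of_charCovectors_norm hU hV hmin hVmin (τ := t * I) (by simpa using ht)
    rw [theta3, theta3, thetaSeries_one_ofReal_mul_I, thetaSeries_one_ofReal_mul_I,
      ofReal_inj] at h3
    rw [h3]
  rw [hcard]
  simpa using two_mul_card_le_ncard_unitVectors e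

/-- A unimodular lattice has a characteristic covector whose norm is at most the rank. -/
theorem IsUnimodular.exists_charCovector_norm_sq_le {U : Submodule ℤ E} (hU : IsUnimodular U) :
    ∃ w ∈ charCovectors U, ‖w‖ ^ 2 ≤ finrank ℝ E := by
  by_contra! hcon
  -- If all were longer than the rank allows, U would be the standard lattice, where the sum of the
  -- basis vectors has norm exactly the rank.
  obtain ⟨e, he⟩ := hU.exists_orthonormalBasis fun w hw => (hcon w hw).le
  have hspan : Submodule.span ℤ (Set.range e) = U := by
    refine le_antisymm (Submodule.span_le.2 ?_) fun x hx => (mem_span_orthonormalBasis e).2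
      fun i => hU.integral (he i) hx
    rintro _ ⟨i, rfl⟩
    exact he i
  have h := hcon _ (hspan ▸ sum_mem_charCovectors e)
  rw [norm_sq_sum_orthonormalBasis, Fintype.card_fin] at h
  exact lt_irrefl _ h

end UnitVectors

end

/-! ### Glue vectors, gluing of lattices, and the discriminant group of a bimodular lattice. -/

noncomputable section

open Module

section GlueVector

variable {E F : Type*} [NormedAddCommGroup E] [InnerProductSpace ℝ E] [NormedAddCommGroup F]
  [InnerProductSpace ℝ F]

lemma half_ne_int (k l : ℤ) : (k : ℝ) + 1 / 2 ≠ l := by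
  intro h
  have h1 : (2 * k + 1 : ℝ) = 2 * l := by linarith
  have h2 : 2 * k + 1 = 2 * l := by exact_mod_cast h1
  omega

/-- `g` generates the discriminant group of the integral lattice `L`, which has order two. -/
structure IsGlueVector (L : Submodule ℤ E) (g : E) : Prop where
  integral : ∀ v ∈ L, ∀ w ∈ L, ∃ k : ℤ, ⟪v, w⟫ = (k : ℝ)
  mem_dual : g ∈ dualLattice L
  norm_sq : ∃ k : ℤ, ⟪g, g⟫ = (k : ℝ) + 1 / 2
  cover : ∀ x ∈ dualLattice L, x ∈ L ∨ x - g ∈ L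

namespace IsGlueVector

variable {L : Submodule ℤ E} {g : E} (hg : IsGlueVector L g)

include hg

lemma le_dual : L ≤ dualLattice L := fun v hv => mem_dualLattice.2 fun w hw => hg.integral v hv w hw

lemma inner_mem {v : E} (hv : v ∈ L) : ∃ k : ℤ, ⟪v, g⟫ = (k : ℝ) := by
  obtain ⟨k, hk⟩ := mem_dualLattice.1 hg.mem_dual v hv
  exact ⟨k, by rw [real_inner_comm, hk]⟩

lemma inner_of_notMem {x : E} (hx : x ∈ dualLattice L) (hxL : x ∉ L) :
    ∃ k : ℤ, ⟪x, g⟫ = (k : ℝ) + 1 / 2 := by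
  obtain ⟨k, hk⟩ := hg.inner_mem ((hg.cover x hx).resolve_left hxL)
  obtain ⟨l, hl⟩ := hg.norm_sq
  refine ⟨k + l, ?_⟩
  rw [inner_sub_left, hl] at hk
  push_cast
  linarith

lemma mem_iff {x : E} (hx : x ∈ dualLattice L) : x ∈ L ↔ ∃ k : ℤ, ⟪x, g⟫ = (k : ℝ) := by
  refine ⟨hg.inner_mem, fun ⟨k, hk⟩ => ?_⟩
  by_contra hxL
  obtain ⟨l, hl⟩ := hg.inner_of_notMem hx hxL
  exact half_ne_int l k (hl ▸ hk)

lemma two_smul_mem {x : E} (hx : x ∈ dualLattice L) : (2 : ℝ) • x ∈ L := by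
  rw [two_smul, hg.mem_iff (add_mem hx hx), inner_add_left]
  by_cases hxL : x ∈ L
  · obtain ⟨k, hk⟩ := hg.inner_mem hxL
    exact ⟨2 * k, by rw [hk]; push_cast; ring⟩
  · obtain ⟨k, hk⟩ := hg.inner_of_notMem hx hxL
    exact ⟨2 * k + 1, by rw [hk]; push_cast; ring⟩

lemma inner_notMem_notMem {x y : E} (hx : x ∈ dualLattice L) (hxL : x ∉ L) (hy : y ∈ dualLattice L)
    (hyL : y ∉ L) : ∃ k : ℤ, ⟪x, y⟫ = (k : ℝ) + 1 / 2 := by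
  obtain ⟨k, hk⟩ := hg.inner_of_notMem hx hxL
  obtain ⟨l, hl⟩ := mem_dualLattice.1 hx _ ((hg.cover y hy).resolve_left hyL)
  refine ⟨k + l, ?_⟩
  rw [inner_sub_right, hk] at hl
  push_cast
  linarith

/-- A characteristic covector pairs integrally with the whole dual lattice. -/
lemma inner_charCovector {ξ : E} (hξ : ξ ∈ charCovectors L) : ∃ k : ℤ, ⟪ξ, g⟫ = (k : ℝ) := by
  -- Testing on 2g ∈ L, the congruence 2⟨ξ, g⟩ ≡ 4g² (mod 2) puts ⟨ξ, g⟩ in 2g² + ℤ = ℤ.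
  obtain ⟨k, hk⟩ := hξ.2 _ (hg.two_smul_mem hg.mem_dual)
  obtain ⟨l, hl⟩ := hg.norm_sq
  refine ⟨k + 2 * l + 1, ?_⟩
  rw [real_inner_smul_right, real_inner_smul_left, real_inner_smul_right, hl] at hk
  push_cast
  linarith

end IsGlueVector

/-- The overlattice of `L ⊕ M` obtained by adjoining the vector `(g, h)`, described as the vectors
of the dual of `L ⊕ M` that pair integrally with `(g, h)`. -/
def glueLattice (L : Submodule ℤ E) (g : E) (M : Submodule ℤ F) (h : F) :
    Submodule ℤ (WithLp 2 (E × F)) where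
  carrier := {p | p.fst ∈ dualLattice L ∧ p.snd ∈ dualLattice M ∧
    ∃ k : ℤ, ⟪p.fst, g⟫ + ⟪p.snd, h⟫ = (k : ℝ)}
  zero_mem' := ⟨zero_mem _, zero_mem _, 0, by simp⟩
  add_mem' := by
    rintro p q ⟨hp1, hp2, k, hk⟩ ⟨hq1, hq2, l, hl⟩
    refine ⟨add_mem hp1 hq1, add_mem hp2 hq2, k + l, ?_⟩
    rw [WithLp.add_fst, WithLp.add_snd, inner_add_left, inner_add_left]
    push_cast
    linarith
  smul_mem' := by
    rintro a p ⟨hp1, hp2, k, hk⟩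
    refine ⟨Submodule.smul_mem _ a hp1, Submodule.smul_mem _ a hp2, a * k, ?_⟩
    rw [WithLp.smul_fst, WithLp.smul_snd, ← Int.cast_smul_eq_zsmul ℝ, ← Int.cast_smul_eq_zsmul ℝ,
      real_inner_smul_left, real_inner_smul_left]
    push_cast
    rw [← hk]
    ring

variable {L : Submodule ℤ E} {g : E} {M : Submodule ℤ F} {h : F}

lemma toLp_mem_glueLattice (hg : IsGlueVector L g) (hh : IsGlueVector M h) {x : E} {y : F}
    (hx : x ∈ L) (hy : y ∈ M) : WithLp.toLp 2 (x, y) ∈ glueLattice L g M h := by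
  obtain ⟨k, hk⟩ := hg.inner_mem hx
  obtain ⟨l, hl⟩ := hh.inner_mem hy
  refine ⟨hg.le_dual hx, hh.le_dual hy, k + l, ?_⟩
  push_cast
  rw [← hk, ← hl]
  rfl

lemma toLp_glue_mem_glueLattice (hg : IsGlueVector L g) (hh : IsGlueVector M h) :
    WithLp.toLp 2 (g, h) ∈ glueLattice L g M h := by
  obtain ⟨k, hk⟩ := hg.norm_sq
  obtain ⟨l, hl⟩ := hh.norm_sq
  refine ⟨hg.mem_dual, hh.mem_dual, k + l + 1, ?_⟩
  change ⟪g, g⟫ + ⟪h, h⟫ = _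
  rw [hk, hl]
  push_cast
  ring

/-- The two components of a vector of the glued lattice lie in corresponding cosets. -/
lemma cover_glueLattice (hg : IsGlueVector L g) (hh : IsGlueVector M h) {p : WithLp 2 (E × F)}
    (hp : p ∈ glueLattice L g M h) :
    (p.fst ∈ L ∧ p.snd ∈ M) ∨ (p.fst - g ∈ L ∧ p.snd - h ∈ M) := by
  obtain ⟨hp1, hp2, k, hk⟩ := hp
  by_cases h1 : p.fst ∈ L
  · obtain ⟨l, hl⟩ := hg.inner_mem h1
    refine Or.inl ⟨h1, (hh.mem_iff hp2).2 ⟨k - l, ?_⟩⟩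
    push_cast
    linarith
  · obtain ⟨l, hl⟩ := hg.inner_of_notMem hp1 h1
    refine Or.inr ⟨(hg.cover _ hp1).resolve_left h1, (hh.cover _ hp2).resolve_left fun h2 => ?_⟩
    obtain ⟨j, hj⟩ := hh.inner_mem h2
    refine half_ne_int l (k - j) ?_
    push_cast
    linarith

/-- Pairing with L ⊕ 0, 0 ⊕ M and (g, h) yields exactly the defining conditions. Conversely these
generate the glued lattice, by `cover_glueLattice`, so it lies in its own dual. -/
lemma isUnimodular_glueLattice (hg : IsGlueVector L g) (hh : IsGlueVector M h) :
    IsUnimodular (glueLattice L g M h) := by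
  ext q
  rw [mem_dualLattice]
  constructor
  · intro hq
    refine ⟨mem_dualLattice.2 fun v hv => ?_, mem_dualLattice.2 fun v hv => ?_, ?_⟩
    · obtain ⟨k, hk⟩ := hq _ (toLp_mem_glueLattice hg hh hv (zero_mem M))
      exact ⟨k, by simpa [WithLp.prod_inner_apply] using hk⟩
    · obtain ⟨k, hk⟩ := hq _ (toLp_mem_glueLattice hg hh (zero_mem L) hv)
      exact ⟨k, by simpa [WithLp.prod_inner_apply] using hk⟩
    · exact hq _ (toLp_glue_mem_glueLattice hg hh)
  · rintro ⟨hq1, hq2, k, hk⟩ p hp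
    rw [WithLp.prod_inner_apply]
    rcases cover_glueLattice hg hh hp with ⟨h1, h2⟩ | ⟨h1, h2⟩
    · obtain ⟨i, hi⟩ := mem_dualLattice.1 hq1 _ h1
      obtain ⟨j, hj⟩ := mem_dualLattice.1 hq2 _ h2
      exact ⟨i + j, by push_cast; rw [← hi, ← hj]; rfl⟩
    · obtain ⟨i, hi⟩ := mem_dualLattice.1 hq1 _ h1
      obtain ⟨j, hj⟩ := mem_dualLattice.1 hq2 _ h2
      refine ⟨k + i + j, ?_⟩
      rw [inner_sub_right] at hi hj
      change ⟪q.fst, p.fst⟫ + ⟪q.snd, p.snd⟫ = _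
      push_cast
      linarith

lemma fst_mem_charCovectors (hg : IsGlueVector L g) (hh : IsGlueVector M h)
    {w : WithLp 2 (E × F)} (hw : w ∈ charCovectors (glueLattice L g M h)) :
    w.fst ∈ charCovectors L := by
  have hwU : w ∈ glueLattice L g M h := isUnimodular_glueLattice hg hh ▸ hw.1
  refine ⟨hwU.1, fun v hv => ?_⟩
  obtain ⟨k, hk⟩ := hw.2 _ (toLp_mem_glueLattice hg hh hv (zero_mem M))
  exact ⟨k, by simpa [WithLp.prod_inner_apply] using hk⟩

lemma snd_mem_charCovectors (hg : IsGlueVector L g) (hh : IsGlueVector M h)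
    {w : WithLp 2 (E × F)} (hw : w ∈ charCovectors (glueLattice L g M h)) :
    w.snd ∈ charCovectors M := by
  have hwU : w ∈ glueLattice L g M h := isUnimodular_glueLattice hg hh ▸ hw.1
  refine ⟨hwU.2.1, fun v hv => ?_⟩
  obtain ⟨k, hk⟩ := hw.2 _ (toLp_mem_glueLattice hg hh (zero_mem L) hv)
  exact ⟨k, by simpa [WithLp.prod_inner_apply] using hk⟩

/-- A pair of characteristic covectors is characteristic for the glued lattice if it has the right
parity on the glue vector. -/
lemma toLp_mem_charCovectors (hg : IsGlueVector L g) (hh : IsGlueVector M h) {ξ : E} {η : F}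
    (hξ : ξ ∈ charCovectors L) (hη : η ∈ charCovectors M)
    (hpar : ∃ k : ℤ, ⟪ξ, g⟫ + ⟪η, h⟫ - (⟪g, g⟫ + ⟪h, h⟫) = 2 * (k : ℝ)) :
    WithLp.toLp 2 (ξ, η) ∈ charCovectors (glueLattice L g M h) := by
  have hU := isUnimodular_glueLattice hg hh
  obtain ⟨c, hc⟩ := hpar
  refine ⟨?_, fun p hp => ?_⟩
  · rw [hU]
    obtain ⟨i, hi⟩ := hg.inner_charCovector hξ
    obtain ⟨j, hj⟩ := hh.inner_charCovector hη
    refine ⟨hξ.1, hη.1, i + j, ?_⟩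
    push_cast
    rw [← hi, ← hj]
    rfl
  · rw [WithLp.prod_inner_apply, WithLp.prod_inner_apply]
    change ∃ k : ℤ, ⟪ξ, p.fst⟫ + ⟪η, p.snd⟫ - (⟪p.fst, p.fst⟫ + ⟪p.snd, p.snd⟫) = 2 * (k : ℝ)
    rcases cover_glueLattice hg hh hp with ⟨h1, h2⟩ | ⟨h1, h2⟩
    · obtain ⟨i, hi⟩ := hξ.2 _ h1
      obtain ⟨j, hj⟩ := hη.2 _ h2
      exact ⟨i + j, by push_cast; linarith⟩
    · obtain ⟨i, hi⟩ := hξ.2 _ h1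
      obtain ⟨j, hj⟩ := hη.2 _ h2
      obtain ⟨a, ha⟩ := hg.inner_mem h1
      obtain ⟨b, hb⟩ := hh.inner_mem h2
      refine ⟨i + j + c - a - b, ?_⟩
      have e1 : p.fst = (p.fst - g) + g := by abel
      have e2 : p.snd = (p.snd - h) + h := by abel
      rw [e1, e2]
      generalize p.fst - g = x at *
      generalize p.snd - h = y at *
      rw [real_inner_add_add_self, real_inner_add_add_self, inner_add_right, inner_add_right]
      push_cast
      linarith

lemma norm_sq_withLp_prod (p : WithLp 2 (E × F)) : ‖p‖ ^ 2 = ‖p.fst‖ ^ 2 + ‖p.snd‖ ^ 2 := by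
  rw [← real_inner_self_eq_norm_sq, WithLp.prod_inner_apply, real_inner_self_eq_norm_sq,
    real_inner_self_eq_norm_sq]
  rfl

lemma finrank_withLp_prod [FiniteDimensional ℝ E] [FiniteDimensional ℝ F] :
    finrank ℝ (WithLp 2 (E × F)) = finrank ℝ E + finrank ℝ F := by
  rw [(WithLp.linearEquiv 2 ℝ (E × F)).finrank_eq, finrank_prod]

end GlueVector

section Examples

lemma real_inner_eq_mul (x y : ℝ) : ⟪x, y⟫ = x * y := by
  simp [mul_comm]

lemma mem_latticeA1 {x : ℝ} : x ∈ latticeA1 ↔ ∃ k : ℤ, x = k * √2 := by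
  rw [latticeA1, Submodule.mem_span_singleton]
  simp [eq_comm]

lemma isGlueVector_latticeA1 : IsGlueVector latticeA1 (√2 / 2) := by
  have h2 : √2 * √2 = 2 := Real.mul_self_sqrt (by norm_num)
  refine ⟨?_, ?_, ⟨0, ?_⟩, ?_⟩
  · intro v hv w hw
    obtain ⟨k, rfl⟩ := mem_latticeA1.1 hv
    obtain ⟨l, rfl⟩ := mem_latticeA1.1 hw
    refine ⟨2 * k * l, ?_⟩
    rw [real_inner_eq_mul]
    push_cast
    linear_combination (k * l : ℝ) * h2
  · refine mem_dualLattice.2 fun v hv => ?_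
    obtain ⟨k, rfl⟩ := mem_latticeA1.1 hv
    refine ⟨k, ?_⟩
    rw [real_inner_eq_mul]
    linear_combination (k / 2 : ℝ) * h2
  · rw [real_inner_eq_mul]
    push_cast
    linear_combination (1 / 4 : ℝ) * h2
  · intro x hx
    obtain ⟨k, hk⟩ := mem_dualLattice.1 hx (√2) (mem_latticeA1.2 ⟨1, by simp⟩)
    rw [real_inner_eq_mul] at hk
    have hx' : x = k * (√2 / 2) := by linear_combination (√2 / 2) * hk - (x / 2) * h2
    rcases Int.even_or_odd' k with ⟨l, rfl | rfl⟩
    · left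
      refine mem_latticeA1.2 ⟨l, ?_⟩
      rw [hx']
      push_cast
      ring
    · right
      refine mem_latticeA1.2 ⟨l, ?_⟩
      rw [hx']
      push_cast
      ring

lemma int_mul_sqrt_two_mem_charCovectors (k : ℤ) : k * √2 ∈ charCovectors latticeA1 := by
  have h2 : √2 * √2 = 2 := Real.mul_self_sqrt (by norm_num)
  refine ⟨isGlueVector_latticeA1.le_dual (mem_latticeA1.2 ⟨k, rfl⟩), fun v hv => ?_⟩
  obtain ⟨l, rfl⟩ := mem_latticeA1.1 hv
  refine ⟨k * l - l * l, ?_⟩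
  rw [real_inner_eq_mul, real_inner_eq_mul]
  push_cast
  linear_combination (k * l - l * l : ℝ) * h2

/-- A bimodular lattice has a discriminant group of order two. -/
lemma IsBimodular.exists_isGlueVector {n : ℕ} {L : Submodule ℤ (EuclideanSpace ℝ (Fin n))}
    (hL : IsBimodular L) : ∃ g, IsGlueVector L g := by
  obtain ⟨b, hb⟩ := hL.det_eq_two
  have hli : LinearIndependent ℝ (fun i => (b i : EuclideanSpace ℝ (Fin n))) :=
    Matrix.linearIndependent_of_det_gram_ne_zero (𝕜 := ℝ) (by rw [hb]; norm_num)
  let β : Basis (Fin n) ℝ (EuclideanSpace ℝ (Fin n)) := Basis.mk hli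
    (hli.span_eq_top_of_card_eq_finrank' (by simp)).ge
  have hβ : ∀ i, β i = b i := fun i => by simp [β]
  have hspan : Submodule.span ℤ (Set.range β) = L := by
    have h1 : Set.range β = L.subtype '' Set.range b := by
      rw [← Set.range_comp]
      congr 1
      funext i
      exact hβ i
    rw [h1, ← Submodule.map_span, b.span_eq, Submodule.map_subtype_top]
  let δ := LinearMap.BilinForm.dualBasis (innerₗ (EuclideanSpace ℝ (Fin n))) innerₗ_nondegenerate β
  have hδ : Submodule.span ℤ (Set.range δ) = dualLattice L := by
    rw [← LinearMap.BilinForm.dualSubmodule_span_of_basis, hspan]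
    rfl
  have hle : L ≤ dualLattice L := fun v hv => mem_dualLattice.2 fun w hw => hL.integral v hv w hw
  let d : Basis (Fin n) ℤ (dualLattice L) := (δ.restrictScalars ℤ).map (LinearEquiv.ofEq _ _ hδ)
  have hdrepr : ∀ (x : dualLattice L) (i : Fin n), ((d.repr x i : ℤ) : ℝ) = ⟪(x : EuclideanSpace ℝ (Fin n)), b i⟫ := by
    intro x i
    have h1 := δ.restrictScalars_repr_apply ℤ ((LinearEquiv.ofEq _ _ hδ).symm x) i
    rw [LinearMap.BilinForm.dualBasis_repr_apply, hβ] at h1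
    exact h1
  -- The matrix of a basis of L in the dual basis is its Gram matrix, so the index is the
  -- determinant.
  have hindex : L.toAddSubgroup.relIndex (dualLattice L).toAddSubgroup = 2 := by
    refine (AddSubgroup.relIndex_eq_natAbs_det L.toAddSubgroup (dualLattice L).toAddSubgroup
      hle b d).trans ?_
    suffices h : ((d.det (fun i => ⟨b i, hle (b i).2⟩) : ℤ) : ℝ) = 2 by
      have h' : d.det (fun i => ⟨b i, hle (b i).2⟩) = 2 := by exact_mod_cast h
      exact congrArg Int.natAbs h'
    rw [← hb, Basis.det_apply]
    refine ((Int.castRingHom ℝ).map_det _).trans ?_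
    congr 1
    ext i j
    exact (hdrepr _ i).trans (real_inner_comm _ _)
  obtain ⟨g, hgd, hgL, hcov⟩ := AddSubgroup.relIndex_eq_two_iff_exists_notMem_and.1 hindex
  have hgd' : g ∈ dualLattice L := hgd
  have hgL' : g ∉ L := hgL
  have h2g : g + g ∈ L := (hcov g hgd).resolve_right hgL
  have hcover : ∀ x ∈ dualLattice L, x ∈ L ∨ x - g ∈ L := by
    intro x hx
    rcases hcov x hx with h | h
    · right
      have h' : x + g ∈ L := h
      have := sub_mem h' h2g
      rwa [add_sub_add_right_eq_sub] at this
    · exact Or.inl h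
  refine ⟨g, hL.integral, hgd', ?_, hcover⟩
  obtain ⟨k, hk⟩ := mem_dualLattice.1 hgd' _ h2g
  rw [inner_add_right] at hk
  -- Here 2g² = k. If k were even, g would pair integrally with all of L', so g ∈ L'' = L.
  rcases Int.even_or_odd' k with ⟨l, rfl | rfl⟩
  · exfalso
    apply hgL'
    have hdd : dualLattice (dualLattice L) = L := by
      have := LinearMap.BilinForm.dualSubmodule_dualSubmodule_of_basis (R := ℤ)
        (innerₗ (EuclideanSpace ℝ (Fin n))) innerₗ_nondegenerate
        ⟨fun x y => by simp [real_inner_comm]⟩ β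
      rwa [hspan] at this
    rw [← hdd, mem_dualLattice]
    intro x hx
    rcases hcover x hx with h | h
    · exact mem_dualLattice.1 hgd' x h
    · obtain ⟨j, hj⟩ := mem_dualLattice.1 hgd' _ h
      refine ⟨j + l, ?_⟩
      rw [inner_sub_right] at hj
      push_cast at hk ⊢
      linarith
  · refine ⟨l, ?_⟩
    push_cast at hk
    linarith

end Examples

end

/-! ### The two classes of characteristic covectors and the double of L. -/

noncomputable section

open Module

section Classes

variable {n : ℕ} {L : Submodule ℤ (EuclideanSpace ℝ (Fin n))} {g : EuclideanSpace ℝ (Fin n)}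

/-- Glue L to A₁ and complete ξ by ε√2. In rank n + 1 van der Blij gives ξ² + 2ε² ≡ n + 1 (mod 8),
and 2ε² is 0 or 2 modulo 8 according to the parity of ε. -/
lemma IsGlueVector.charCovectorsSign_or (hg : IsGlueVector L g) {ξ : EuclideanSpace ℝ (Fin n)}
    (hξ : ξ ∈ charCovectors L) : ξ ∈ charCovectorsSign 1 L ∨ ξ ∈ charCovectorsSign (-1) L := by
  have h2 : √2 * √2 = 2 := Real.mul_self_sqrt (by norm_num)
  obtain ⟨j, hj⟩ := hg.inner_charCovector hξ
  obtain ⟨k, hk⟩ := hg.norm_sq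
  -- This value solves ⟨ξ, g⟩ + ε = g² + 1/2, the parity condition on the glue vector with
  -- difference 0.
  obtain ⟨ε, hε⟩ : ∃ ε : ℤ, ε = k + 1 - j := ⟨_, rfl⟩
  have hε' : (ε : ℝ) = k + 1 - j := by rw [hε]; push_cast; rfl
  have hw := toLp_mem_charCovectors hg isGlueVector_latticeA1 hξ
    (int_mul_sqrt_two_mem_charCovectors ε) ⟨0, by
      rw [hj, hk, real_inner_eq_mul, real_inner_eq_mul]
      push_cast
      linear_combination (ε / 2 - 1 / 4 : ℝ) * h2 + hε'⟩
  obtain ⟨m, hm⟩ := (isUnimodular_glueLattice hg isGlueVector_latticeA1).norm_sq_charCovector hw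
  rw [norm_sq_withLp_prod, finrank_withLp_prod, finrank_euclideanSpace_fin, finrank_self] at hm
  have hm' : ⟪ξ, ξ⟫ + 2 * (ε : ℝ) ^ 2 - (n + 1) = 8 * m := by
    rw [real_inner_self_eq_norm_sq, ← hm]
    change _ = ‖ξ‖ ^ 2 + ‖(ε : ℝ) * √2‖ ^ 2 - _
    rw [Real.norm_eq_abs, sq_abs]
    push_cast
    linear_combination (-(ε : ℝ) ^ 2) * h2
  rcases Int.even_or_odd' ε with ⟨l, rfl | rfl⟩
  · refine Or.inl ⟨hξ, m - l ^ 2, ?_⟩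
    push_cast at hm' ⊢
    linear_combination hm'
  · refine Or.inr ⟨hξ, m - l ^ 2 - l, ?_⟩
    push_cast at hm' ⊢
    linear_combination hm'

lemma disjoint_charCovectorsSign (L : Submodule ℤ (EuclideanSpace ℝ (Fin n))) :
    Disjoint (charCovectorsSign 1 L) (charCovectorsSign (-1) L) := by
  refine Set.disjoint_left.2 ?_
  rintro ξ ⟨-, k, hk⟩ ⟨-, l, hl⟩
  push_cast at hk hl
  have h : (8 * k + 2 : ℝ) = 8 * l := by linarith
  have h' : 8 * k + 2 = 8 * l := by exact_mod_cast h
  omega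

/-- The components of a characteristic covector of the double of `L` lie in opposite classes. -/
lemma IsGlueVector.opposite_sign (hg : IsGlueVector L g)
    {w : WithLp 2 (EuclideanSpace ℝ (Fin n) × EuclideanSpace ℝ (Fin n))}
    (hw : w ∈ charCovectors (glueLattice L g L g)) :
    (w.fst ∈ charCovectorsSign 1 L ∧ w.snd ∈ charCovectorsSign (-1) L) ∨
      (w.fst ∈ charCovectorsSign (-1) L ∧ w.snd ∈ charCovectorsSign 1 L) := by
  obtain ⟨m, hm⟩ := (isUnimodular_glueLattice hg hg).norm_sq_charCovector hw
  rw [norm_sq_withLp_prod, finrank_withLp_prod, finrank_euclideanSpace_fin,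
    ← real_inner_self_eq_norm_sq, ← real_inner_self_eq_norm_sq] at hm
  push_cast at hm
  rcases hg.charCovectorsSign_or (fst_mem_charCovectors hg hg hw) with h1 | h1 <;>
    rcases hg.charCovectorsSign_or (snd_mem_charCovectors hg hg hw) with h2 | h2
  · exfalso
    obtain ⟨-, k, hk⟩ := h1
    obtain ⟨-, l, hl⟩ := h2
    push_cast at hk hl
    have h : (8 * k + 8 * l + 2 : ℝ) = 8 * m := by linarith
    have h' : 8 * k + 8 * l + 2 = 8 * m := by exact_mod_cast h
    omega
  · exact Or.inl ⟨h1, h2⟩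
  · exact Or.inr ⟨h1, h2⟩
  · exfalso
    obtain ⟨-, k, hk⟩ := h1
    obtain ⟨-, l, hl⟩ := h2
    push_cast at hk hl
    have h : (8 * k + 8 * l - 2 : ℝ) = 8 * m := by linarith
    have h' : 8 * k + 8 * l - 2 = 8 * m := by exact_mod_cast h
    omega

/-- One short characteristic covector of the double, whose rank is 2n, supplies both vectors; in
particular both classes are non-empty. -/
lemma IsGlueVector.exists_pair_norm_sq_le (hg : IsGlueVector L g) :
    ∃ ξ ∈ charCovectorsSign 1 L, ∃ η ∈ charCovectorsSign (-1) L, ⟪ξ, ξ⟫ + ⟪η, η⟫ ≤ 2 * n := by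
  obtain ⟨w, hw, hle⟩ := (isUnimodular_glueLattice hg hg).exists_charCovector_norm_sq_le
  rw [norm_sq_withLp_prod, finrank_withLp_prod, finrank_euclideanSpace_fin,
    ← real_inner_self_eq_norm_sq, ← real_inner_self_eq_norm_sq] at hle
  push_cast at hle
  rcases hg.opposite_sign hw with ⟨h1, h2⟩ | ⟨h1, h2⟩
  · exact ⟨_, h1, _, h2, by linarith⟩
  · exact ⟨_, h2, _, h1, by linarith⟩

/-- The squares in a class are nonnegative and lie in one coset of 8ℤ, so the minimum is that of a
set of integers bounded below. -/
lemma isLeast_defect {s : ℤˣ} (hne : (charCovectorsSign s L).Nonempty) :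
    IsLeast (defectValues s L) (defect s L) := by
  obtain ⟨ξ₀, hξ₀⟩ := hne
  have hs : ((s : ℤ) : ℝ) ≤ 1 := by
    rcases Int.units_eq_one_or s with rfl | rfl <;> norm_num
  obtain ⟨k, ⟨ξ, hξ, hk⟩, hmin⟩ := Int.exists_least_of_bdd
    (P := fun k : ℤ => ∃ ξ ∈ charCovectorsSign s L, ⟪ξ, ξ⟫ - ((n : ℝ) + ((s : ℤ) : ℝ)) = 8 * (k : ℝ))
    ⟨-(n + 1), by
      rintro k ⟨ξ, -, hk⟩
      have h0 : 0 ≤ ⟪ξ, ξ⟫ := real_inner_self_nonneg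
      have h : (-(n + 1) : ℝ) ≤ 8 * k := by linarith
      have h' : -(n + 1 : ℤ) ≤ 8 * k := by exact_mod_cast h
      omega⟩ (hξ₀.2.imp fun k hk => ⟨ξ₀, hξ₀, hk⟩)
  have hleast : IsLeast (defectValues s L) ((⟪ξ, ξ⟫ - (n : ℝ)) / 4) := by
    refine ⟨⟨ξ, hξ, rfl⟩, ?_⟩
    rintro _ ⟨η, hη, rfl⟩
    obtain ⟨l, hl⟩ := hη.2
    have : (k : ℝ) ≤ l := by exact_mod_cast hmin l ⟨η, hη, hl⟩
    simp only
    linarith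
  rwa [defect, hleast.csInf_eq]

end Classes

/-! ### Recovering L from an orthonormal basis of its double. -/

section Double

variable {E : Type*} [NormedAddCommGroup E] [InnerProductSpace ℝ E] {L : Submodule ℤ E} {g : E}

lemma IsGlueVector.notMem (hg : IsGlueVector L g) : g ∉ L := fun h => by
  obtain ⟨k, hk⟩ := hg.norm_sq
  obtain ⟨l, hl⟩ := hg.integral g h g h
  exact half_ne_int k l (hk ▸ hl)

lemma real_smul_mem_of_int {x : E} (hx : x ∈ L) {c : ℝ} (hc : ∃ k : ℤ, c = k) : c • x ∈ L := by
  obtain ⟨k, rfl⟩ := hc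
  rw [Int.cast_smul_eq_zsmul]
  exact L.smul_mem k hx

/-- The unit vectors of the double of `L`: they come from one of the two summands, or have two
components of square `1/2`. -/
lemma IsGlueVector.unit_glueLattice (hg : IsGlueVector L g) {p : WithLp 2 (E × E)}
    (hp : p ∈ glueLattice L g L g) (hp1 : ‖p‖ = 1) :
    (p.fst ∈ L ∧ p.snd = 0) ∨ p.fst = 0 ∨
      (p.fst ∈ dualLattice L ∧ p.fst ∉ L ∧ ⟪p.fst, p.fst⟫ = 1 / 2) := by
  have hsum : ⟪p.fst, p.fst⟫ + ⟪p.snd, p.snd⟫ = 1 := by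
    rw [real_inner_self_eq_norm_sq, real_inner_self_eq_norm_sq, ← norm_sq_withLp_prod, hp1, one_pow]
  have h1 : 0 ≤ ⟪p.fst, p.fst⟫ := real_inner_self_nonneg
  have h2 : 0 ≤ ⟪p.snd, p.snd⟫ := real_inner_self_nonneg
  rcases cover_glueLattice hg hg hp with ⟨hx, hy⟩ | ⟨hx, hy⟩
  · obtain ⟨a, ha⟩ := hg.integral _ hx _ hx
    obtain ⟨b, hb⟩ := hg.integral _ hy _ hy
    rw [ha, hb] at hsum
    rw [ha] at h1
    rw [hb] at h2
    norm_cast at hsum h1 h2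
    obtain rfl | rfl : a = 0 ∨ b = 0 := by omega
    · exact Or.inr (Or.inl ((inner_self_eq_zero (𝕜 := ℝ)).1 (by rw [ha]; simp)))
    · exact Or.inl ⟨hx, (inner_self_eq_zero (𝕜 := ℝ)).1 (by rw [hb]; simp)⟩
  · have hx' : p.fst ∉ L := fun h => hg.notMem (by simpa using sub_mem h hx)
    have hy' : p.snd ∉ L := fun h => hg.notMem (by simpa using sub_mem h hy)
    obtain ⟨a, ha⟩ := hg.inner_notMem_notMem hp.1 hx' hp.1 hx'
    obtain ⟨b, hb⟩ := hg.inner_notMem_notMem hp.2.1 hy' hp.2.1 hy'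
    refine Or.inr (Or.inr ⟨hp.1, hx', ?_⟩)
    have h3 : (-1 : ℝ) < a := by linarith
    have h4 : (-1 : ℝ) < b := by linarith
    have h5 : (a : ℝ) + b = 0 := by linarith
    norm_cast at h3 h4 h5
    obtain rfl : a = 0 := by omega
    rw [ha]
    simp

/-- Two vectors of square `1/2` in the nontrivial coset agree up to sign. -/
lemma IsGlueVector.eq_or_eq_neg (hg : IsGlueVector L g) {x y : E} (hx : x ∈ dualLattice L)
    (hxL : x ∉ L) (hx2 : ⟪x, x⟫ = 1 / 2) (hy : y ∈ dualLattice L) (hyL : y ∉ L)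
    (hy2 : ⟪y, y⟫ = 1 / 2) : y = x ∨ y = -x := by
  -- The product ⟨x, y⟩ is in 1/2 + ℤ, and (y ± x)² = 1 ± 2⟨x, y⟩ ≥ 0 leaves only ±1/2, where y - x
  -- or y + x has square zero.
  obtain ⟨k, hk⟩ := hg.inner_notMem_notMem hx hxL hy hyL
  have h1 : 0 ≤ ⟪y - x, y - x⟫ := real_inner_self_nonneg
  have h2 : 0 ≤ ⟪y + x, y + x⟫ := real_inner_self_nonneg
  rw [real_inner_sub_sub_self, hx2, hy2, real_inner_comm, hk] at h1
  rw [real_inner_add_add_self, hx2, hy2, real_inner_comm, hk] at h2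
  have h3 : (k : ℝ) < 1 := by linarith
  have h4 : (-2 : ℝ) < k := by linarith
  norm_cast at h3 h4
  obtain rfl | rfl : k = 0 ∨ k = -1 := by omega
  · left
    rw [← sub_eq_zero, ← inner_self_eq_zero (𝕜 := ℝ), real_inner_sub_sub_self, hx2, hy2,
      real_inner_comm, hk]
    norm_num
  · right
    rw [← sub_eq_zero, sub_neg_eq_add, ← inner_self_eq_zero (𝕜 := ℝ), real_inner_add_add_self, hx2,
      hy2, real_inner_comm, hk]
    norm_num

/-- If the double of `L` has an orthonormal basis, then `L` is an orthogonal sum of copies of `ℤ`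
and a copy of `A₁`. -/
lemma IsGlueVector.exists_orthonormalBasis {ι : Type*} [Fintype ι] (hg : IsGlueVector L g)
    (e : OrthonormalBasis ι ℝ (WithLp 2 (E × E))) (he : ∀ i, e i ∈ glueLattice L g L g) :
    ∃ (m : ℕ) (b : OrthonormalBasis (Fin m ⊕ Unit) ℝ E), (∀ i, b (Sum.inl i) ∈ L) ∧
      √2 • b (Sum.inr ()) ∈ L ∧ ∀ v ∈ L, ∃ k : ℤ, ⟪b (Sum.inr ()), v⟫ = k * √2 := by
  classical
  have h2 : √2 * √2 = 2 := Real.mul_self_sqrt (by norm_num)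
  have hclass := fun i => hg.unit_glueLattice (he i) (e.orthonormal.norm_eq_one i)
  have hexp : ∀ v : E, ∑ i, ⟪(e i).fst, v⟫ • (e i).fst = v := by
    intro v
    have h := congrArg (fun p : WithLp 2 (E × E) => (WithLp.linearEquiv 2 ℝ (E × E) p).1)
      (e.sum_repr' (WithLp.toLp 2 (v, 0)))
    simpa [WithLp.prod_inner_apply, Prod.fst_sum] using h
  -- Otherwise every first component is in L, and the expansion `hexp g` would have integral
  -- coefficients and put g in L.
  obtain ⟨j, hj1, hj2, hj3⟩ : ∃ j, (e j).fst ∈ dualLattice L ∧ (e j).fst ∉ L ∧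
      ⟪(e j).fst, (e j).fst⟫ = 1 / 2 := by
    by_contra! hno
    refine hg.notMem ?_
    rw [← hexp g]
    refine sum_mem fun i _ => ?_
    rcases hclass i with ⟨h, -⟩ | h | ⟨ha, hb, hc⟩
    · exact real_smul_mem_of_int h (hg.inner_mem h)
    · rw [h, smul_zero]
      exact zero_mem L
    · exact absurd hc (hno i ha hb)
  set x := (e j).fst with hx
  have hinner : ∀ i i', (e i).snd = 0 → ⟪(e i).fst, (e i').fst⟫ = if i = i' then 1 else 0 := by
    intro i i' hi
    rw [← orthonormal_iff_ite.1 e.orthonormal i i', WithLp.prod_inner_apply]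
    change _ = ⟪(e i).fst, (e i').fst⟫ + ⟪(e i).snd, (e i').snd⟫
    rw [hi, inner_zero_left, add_zero]
  have hmemL : ∀ i, (e i).snd = 0 → (e i).fst ∈ L := by
    intro i hi
    have h1 := hinner i i hi
    rw [if_pos rfl] at h1
    rcases hclass i with ⟨h, -⟩ | h | ⟨-, -, h⟩
    · exact h
    · rw [h, inner_zero_left] at h1
      norm_num at h1
    · rw [h] at h1
      norm_num at h1
  have hne : ∀ i, (e i).snd = 0 → i ≠ j := by
    rintro i hi rfl
    exact hj2 (hmemL i hi)
  let f : Fin (Fintype.card {i // (e i).snd = 0}) ≃ {i // (e i).snd = 0} := (Fintype.equivFin _).symm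
  -- The members of the basis lying in the first summand, together with x normalised. They span
  -- because every remaining first component is 0 or ±x.
  let c : Fin (Fintype.card {i // (e i).snd = 0}) ⊕ Unit → E :=
    Sum.elim (fun i => (e (f i)).fst) (fun _ => √2 • x)
  have hxx : ⟪√2 • x, √2 • x⟫ = 1 := by
    rw [real_inner_smul_left, real_inner_smul_right, hj3]
    linear_combination (1 / 2 : ℝ) * h2
  have hix : ∀ i, ⟪(e (f i)).fst, √2 • x⟫ = 0 := by
    intro i
    rw [real_inner_smul_right, hx, hinner _ _ (f i).2, if_neg (hne _ (f i).2), mul_zero]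
  have hc : Orthonormal ℝ c := by
    rw [orthonormal_iff_ite]
    rintro (i | i) (i' | i')
    · simp [c, hinner _ _ (f i).2, Subtype.coe_inj]
    · simpa [c] using hix i
    · simpa [c, real_inner_comm] using hix i'
    · simpa [c] using hxx
  have hxspan : x ∈ Submodule.span ℝ (Set.range c) := by
    have h : √2 • x ∈ Submodule.span ℝ (Set.range c) := Submodule.subset_span ⟨Sum.inr (), rfl⟩
    have h' := Submodule.smul_mem _ (√2)⁻¹ h
    rwa [smul_smul, inv_mul_cancel₀ (by positivity), one_smul] at h'
  have hspan : ⊤ ≤ Submodule.span ℝ (Set.range c) := by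
    intro v _
    rw [← hexp v]
    refine sum_mem fun i _ => Submodule.smul_mem _ _ ?_
    rcases hclass i with ⟨-, h⟩ | h | ⟨ha, hb, hc⟩
    · exact Submodule.subset_span ⟨Sum.inl (f.symm ⟨i, h⟩), by simp [c]⟩
    · rw [h]
      exact zero_mem _
    · rcases hg.eq_or_eq_neg hj1 hj2 hj3 ha hb hc with h | h <;> rw [h]
      · exact hxspan
      · exact neg_mem hxspan
  refine ⟨_, OrthonormalBasis.mk hc hspan, fun i => ?_, ?_, fun v hv => ?_⟩
  · rw [OrthonormalBasis.coe_mk]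
    exact hmemL _ (f i).2
  · rw [OrthonormalBasis.coe_mk]
    change √2 • √2 • x ∈ L
    rw [smul_smul, h2]
    exact hg.two_smul_mem hj1
  · rw [OrthonormalBasis.coe_mk]
    change ∃ k : ℤ, ⟪√2 • x, v⟫ = k * √2
    obtain ⟨k, hk⟩ := mem_dualLattice.1 hj1 v hv
    exact ⟨k, by rw [real_inner_smul_left, hk, mul_comm]⟩

/-- A lattice with an orthogonal basis consisting of `m` vectors of square one and one vector of
square two is isometric to `I^m ⊕ A₁`. -/
lemma latticeIsometric_of_orthonormalBasis (hint : ∀ v ∈ L, ∀ w ∈ L, ∃ k : ℤ, ⟪v, w⟫ = (k : ℝ))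
    {m : ℕ} (b : OrthonormalBasis (Fin m ⊕ Unit) ℝ E) (hb : ∀ i, b (Sum.inl i) ∈ L)
    (hb2 : √2 • b (Sum.inr ()) ∈ L)
    (hcoord : ∀ v ∈ L, ∃ k : ℤ, ⟪b (Sum.inr ()), v⟫ = k * √2) :
    LatticeIsometric L (orthogonalSum (latticeI m) latticeA1) := by
  let c := (EuclideanSpace.basisFun (Fin m) ℝ).prod (OrthonormalBasis.singleton Unit ℝ)
  let φ := b.equiv c (Equiv.refl _)
  have hφ : ∀ i v, ⟪c i, φ v⟫ = ⟪b i, v⟫ := by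
    intro i v
    rw [← φ.inner_map_map (b i) v]
    congr 1
    simp [φ]
  have hinl : ∀ i v, ⟪EuclideanSpace.basisFun (Fin m) ℝ i, (φ v).fst⟫ = ⟪b (Sum.inl i), v⟫ := by
    intro i v
    rw [← hφ, WithLp.prod_inner_apply]
    simp [c]
  have hinr : ∀ v, (φ v).snd = ⟪b (Sum.inr ()), v⟫ := by
    intro v
    rw [← hφ, WithLp.prod_inner_apply]
    simp [c]
  have hmem : ∀ v, φ v ∈ orthogonalSum (latticeI m) latticeA1 ↔ v ∈ L := by
    intro v
    have h1 : φ v ∈ orthogonalSum (latticeI m) latticeA1 ↔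
        (φ v).fst ∈ latticeI m ∧ (φ v).snd ∈ latticeA1 := by
      rw [orthogonalSum, Submodule.mem_map_equiv]
      rfl
    rw [h1, latticeI, mem_span_orthonormalBasis, mem_latticeA1, hinr]
    simp only [hinl]
    constructor
    · rintro ⟨h, k, hk⟩
      rw [← b.sum_repr' v, Fintype.sum_sum_type]
      refine add_mem (sum_mem fun i _ => real_smul_mem_of_int (hb i) (h i)) ?_
      rw [Fintype.sum_unique]
      change ⟪b (Sum.inr ()), v⟫ • b (Sum.inr ()) ∈ L
      rw [hk, mul_smul]
      exact real_smul_mem_of_int hb2 ⟨k, rfl⟩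
    · exact fun hv => ⟨fun i => hint _ (hb i) v hv, hcoord v hv⟩
  have hmap : L.map (φ.toLinearEquiv.restrictScalars ℤ).toLinearMap =
      orthogonalSum (latticeI m) latticeA1 := by
    ext p
    rw [Submodule.mem_map_equiv, ← hmem]
    change φ (φ.symm p) ∈ _ ↔ _
    rw [φ.apply_symm_apply]
  exact ⟨(φ.toLinearEquiv.restrictScalars ℤ).ofSubmodules _ _ hmap,
    fun v w => φ.inner_map_map v w⟩

end Double

end

/-! ### Assembly of the theorem. -/

theorem mainTheorem4 {n : ℕ} (L : Submodule ℤ (EuclideanSpace ℝ (Fin n)))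
    (hL : IsBimodular L) :
    -- the characteristic covectors split into the two classes
    charCovectors L = charCovectorsSign 1 L ∪ charCovectorsSign (-1) L ∧
    Disjoint (charCovectorsSign 1 L) (charCovectorsSign (-1) L) ∧
    -- the minima defining the two defects are attained
    IsLeast (defectValues 1 L) (defect 1 L) ∧
    IsLeast (defectValues (-1) L) (defect (-1) L) ∧
    defect 1 L + defect (-1) L ≤ 0 ∧
    (defect 1 L + defect (-1) L = 0 →
      LatticeIsometric L (orthogonalSum (latticeI (n - 1)) latticeA1) ∧
      defect 1 L = 1 / 4 ∧ defect (-1) L = -1 / 4) := by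
  obtain ⟨g, hg⟩ := hL.exists_isGlueVector
  obtain ⟨ξ, hξ, η, hη, hle⟩ := hg.exists_pair_norm_sq_le
  have hplus := isLeast_defect ⟨ξ, hξ⟩
  have hminus := isLeast_defect ⟨η, hη⟩
  have hlb1 : ∀ ζ ∈ charCovectorsSign 1 L, defect 1 L ≤ (⟪ζ, ζ⟫ - n) / 4 :=
    fun ζ hζ => hplus.2 ⟨ζ, hζ, rfl⟩
  have hlb2 : ∀ ζ ∈ charCovectorsSign (-1) L, defect (-1) L ≤ (⟪ζ, ζ⟫ - n) / 4 :=
    fun ζ hζ => hminus.2 ⟨ζ, hζ, rfl⟩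
  refine ⟨?_, disjoint_charCovectorsSign L, hplus, hminus, ?_, fun h0 => ?_⟩
  · ext ζ
    exact ⟨fun h => hg.charCovectorsSign_or h, fun h => h.elim And.left And.left⟩
  · linarith [hlb1 ξ hξ, hlb2 η hη]
  -- The components lie in opposite classes, so ‖w‖² ≥ 2n + 4(d₊ + d₋) = 2n.
  have hmin : ∀ w ∈ charCovectors (glueLattice L g L g),
      (Module.finrank ℝ (WithLp 2 (EuclideanSpace ℝ (Fin n) × EuclideanSpace ℝ (Fin n))) : ℝ) ≤
        ‖w‖ ^ 2 := by
    intro w hw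
    rw [norm_sq_withLp_prod, finrank_withLp_prod, finrank_euclideanSpace_fin,
      ← real_inner_self_eq_norm_sq, ← real_inner_self_eq_norm_sq]
    push_cast
    rcases hg.opposite_sign hw with ⟨h1, h2⟩ | ⟨h1, h2⟩
    · linarith [hlb1 _ h1, hlb2 _ h2]
    · linarith [hlb1 _ h2, hlb2 _ h1]
  obtain ⟨e, he⟩ := (isUnimodular_glueLattice hg hg).exists_orthonormalBasis hmin
  obtain ⟨m, b, hb, hb2, hcoord⟩ := hg.exists_orthonormalBasis e he
  have hn : n = m + 1 := by
    have h := Module.finrank_eq_card_basis b.toBasis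
    rwa [finrank_euclideanSpace_fin, Fintype.card_sum, Fintype.card_fin, Fintype.card_unit] at h
  -- L contains n - 1 orthonormal vectors, and ζ pairs oddly with each.
  have hodd : ∀ ζ ∈ charCovectors L, (n : ℝ) - 1 ≤ ⟪ζ, ζ⟫ := by
    intro ζ hζ
    have h := card_le_norm_sq_of_odd (b.orthonormal.comp Sum.inl Sum.inl_injective) (w := ζ)
      fun i => charCovector_inner_unit hζ (hb i) (b.orthonormal.norm_eq_one _)
    rw [Fintype.card_fin] at h
    have hn' : (n : ℝ) = m + 1 := by exact_mod_cast hn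
    rw [real_inner_self_eq_norm_sq]
    linarith
  refine ⟨?_, ?_⟩
  · rw [show n - 1 = m by omega]
    exact latticeIsometric_of_orthonormalBasis hL.integral b hb hb2 hcoord
  -- In the plus class, ζ² ≥ n - 1 and ζ² ≡ n + 1 (mod 8) give ζ² ≥ n + 1. With the bound -1/4 for
  -- the minus class, the vanishing sum forces both equalities.
  have h1 : 1 / 4 ≤ defect 1 L := by
    obtain ⟨ζ, ⟨hζ, k, hk⟩, hval⟩ := hplus.1
    have h := hodd ζ hζ
    push_cast at hk
    have h3 : (-1 : ℝ) < k := by linarith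
    norm_cast at h3
    have h4 : (0 : ℝ) ≤ k := by exact_mod_cast (by omega : 0 ≤ k)
    rw [← hval]
    simp only
    linarith
  have h2 : -1 / 4 ≤ defect (-1) L := by
    obtain ⟨ζ, ⟨hζ, -⟩, hval⟩ := hminus.1
    rw [← hval]
    simp only
    linarith [hodd ζ hζ]
  constructor <;> linarith
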